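/- Let $F$ be a field and $V$ a vector space over $F$ of finite dimension $n$, and let $\mathbb{G}_k^n(V)$ be the set of $k$-dimensional linear subspaces of $V$. A set $R\subset \mathbb{G}_k^n(V)$ is called regular if there is a base $B$ of $V$ such that every $s\in R$ is spanned by vectors of $B$. A regular transformation of $\mathbb{G}_k^n(V)$ is a bijection $f$ of $\mathbb{G}_k^n(V)$ onto itself such that $f$ and $f^{-1}$ map every regular set onto a regular set; $\mathfrak{R}_k^n(V)$ denotes the set of these. Let $\mathfrak{L}_k^n(V)$ be the set of transformations $s\mapsto u(s)$ of $\mathbb{G}_k^n(V)$, where $u:V\to V$ is a bijection that is $\sigma$-linear for some $\sigma\in \mathrm{Aut}(F)$, that is, $u(x+y)=u(x)+u(y)$ and $u(ax)=\sigma(a)u(x)$ for all $x,y\in V$, $a\in F$. For $\sigma_1,\sigma_2\in\mathrm{Aut}(F)$, a $(\sigma_1,\sigma_2)$-bilinear form on $V$ is a map $\Omega:V\times V\to F$ that is $\sigma_1$-linear in the first and $\sigma_2$-linear in the second argument; it is non-singular if $x\mapsto\Omega(x,\cdot)$ is a bijection of $V$ onto the space of $\sigma_2$-linear maps $V\to F$.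 If $n=2k$, let $\mathfrak{F}_k^{2k}(V)$ be the union of $\mathfrak{L}_k^{2k}(V)$ and the set of transformations $s\mapsto s_\Omega^{\perp}=\{y\in V\mid \Omega(x,y)=0\ \text{for all } x\in s\}$ of $\mathbb{G}_k^{2k}(V)$, where $\Omega$ is a non-singular $(\sigma_1,\sigma_2)$-bilinear form on $V$ for some $\sigma_1,\sigma_2\in\mathrm{Aut}(F)$. Theorem. If $n\neq 2k$, then $\mathfrak{R}_k^n(V)=\mathfrak{L}_k^n(V)$. If $n=2k$ and $k>1$, then $\mathfrak{R}_k^{2k}(V)=\mathfrak{F}_k^{2k}(V)$. -/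

import Mathlib

/-- The Grassmannian of `k`-dimensional linear subspaces ("planes") of `V`. -/
def Grassmannian (F V : Type*) [Field F] [AddCommGroup V] [Module F V] (k : ℕ) : Type _ :=
  {s : Submodule F V // Module.finrank F s = k}

/-- A set `R` of `k`-dimensional planes is regular if there is a base of `V` such that every plane
of `R` is generated by vectors of that base. -/
def IsRegularSet {F V : Type*} [Field F] [AddCommGroup V] [Module F V] {k : ℕ}
    (R : Set (Grassmannian F V k)) : Prop :=
  ∃ b : Module.Basis (Fin (Module.finrank F V)) F V,
    ∀ s ∈ R, ∃ I : Set (Fin (Module.finrank F V)), s.1 = Submodule.span F (b '' I)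

/-- The regular transformations: bijections `f` of the Grassmannian onto itself such that both `f`
and its inverse map every regular set onto a regular set. -/
def regularTransformations (F V : Type*) [Field F] [AddCommGroup V] [Module F V] (k : ℕ) :
    Set (Equiv.Perm (Grassmannian F V k)) :=
  {f | (∀ R : Set (Grassmannian F V k), IsRegularSet R → IsRegularSet (f '' R)) ∧
    ∀ R : Set (Grassmannian F V k), IsRegularSet R → IsRegularSet (f.symm '' R)}

/-- The linear transformations of the Grassmannian: those of the form `s ↦ u(s)` for a bijective
map `u : V → V` that is semilinear with respect to some automorphism `σ` of the field. -/
def linearTransformations (F V : Type*) [Field F] [AddCommGroup V] [Module F V] (k : ℕ) :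
    Set (Equiv.Perm (Grassmannian F V k)) :=
  {f | ∃ (σ : F ≃+* F) (u : V →ₛₗ[(σ : F →+* F)] V),
    Function.Bijective u ∧ ∀ s : Grassmannian F V k, (f s).1 = s.1.map u}

/-- A `(σ₁, σ₂)`-bilinear form `Ω` is non-singular if `x ↦ Ω(x, ·)` is an isomorphism of `V` onto
the space of `σ₂`-linear functionals on `V`. -/
def IsNonsingularForm {F V : Type*} [Field F] [AddCommGroup V] [Module F V] {σ₁ σ₂ : F ≃+* F}
    (Ω : V →ₛₗ[(σ₁ : F →+* F)] V →ₛₗ[(σ₂ : F →+* F)] F) : Prop :=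
  Function.Bijective (fun x => Ω x)

/-- The transformations of the Grassmannian defined by non-singular `(σ₁, σ₂)`-bilinear forms `Ω`:
each plane `s` goes to its `Ω`-orthogonal complement `{y | Ω(x, y) = 0 for all x ∈ s}`. -/
def formTransformations (F V : Type*) [Field F] [AddCommGroup V] [Module F V] (k : ℕ) :
    Set (Equiv.Perm (Grassmannian F V k)) :=
  {f | ∃ (σ₁ σ₂ : F ≃+* F) (Ω : V →ₛₗ[(σ₁ : F →+* F)] V →ₛₗ[(σ₂ : F →+* F)] F),
    IsNonsingularForm Ω ∧
      ∀ s : Grassmannian F V k, (f s).1 = s.1.orthogonalBilin Ω}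

/-!
Fix a basis `b` of `V`. The planes spanned by vectors of `b` form an *apartment*, and the regular
sets are the subsets of apartments. A regular transformation `f` maps apartments onto apartments
(`exists_apartment_map`), hence maps sets lying in two different apartments, called inexact, to
such sets. The maximal inexact subsets of the apartment of `b` are the sets of members `s` for which
`b i ∈ s` implies `b j ∈ s`, where `i ≠ j` are fixed (`isInexact_iff`); so for `2 ≤ k ≤ n - 2` the
map `f` permutes their complements `complementSet k b i j = {s | b i ∈ s, b j ∉ s}`. The number of
complement sets containing given members `s`, `t`, `u` of the apartment is
`dim (s ⊓ t ⊓ u) * (n - dim (s ⊔ t ⊔ u))`, and is therefore an invariant (`finrank_inf_mul_eq`).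
As any two planes lie in a common apartment, the case `t = u` shows that `f` preserves adjacency,
`dim (s ⊓ t) = k - 1`.

The rest of the argument is Chow's theorem. Maximal families of pairwise adjacent planes are stars
(all planes through a fixed `(k - 1)`-plane) and tops (all planes in a fixed `(k + 1)`-plane). Since
adjacency is connected, either all stars go to stars or all go to tops. In the first case `f`
induces a permutation of the `(k - 1)`-planes which is incident with `f`; it again maps stars to stars
(`PreservesIncidence.starToStar`), and descending to points gives a collineation, which is induced
by a semilinear bijection `u` by the fundamental theorem of projective geometry
(`IsCollineationMap.exists_semilinear`). Going up again, `f` is induced by `u`. In the second case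
the invariant of three planes in general position in a star forces `n = 2k`
(`StarToTop.finrank_eq`), and the composition of `f` with the orthogonality of a symmetric
nondegenerate form maps stars to stars.

For `k = 1` and `k = n - 1` all planes are adjacent. There, three different points are collinear if
and only if they do not form a regular set, and dually for hyperplanes; so `f` is a collineation,
respectively maps stars to stars.
-/

/-! ### The fundamental theorem of projective geometry -/

section Collineation

open Module Submodule

variable {F V W : Type*} [Field F] [AddCommGroup V] [Module F V] [AddCommGroup W] [Module F W]

theorem exists_linearIndependent_pair_of_two_le_finrank (hW : 2 ≤ finrank F W) {x : W}
    (hx : x ≠ 0) : ∃ z : W, LinearIndependent F ![x, z] := by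
  by_contra! h
  have hspan : span F {x} = ⊤ := by
    refine eq_top_iff.2 fun z _ => ?_
    have hz := h z
    rw [LinearIndependent.pair_iff' hx] at hz
    push Not at hz
    exact mem_span_singleton.2 hz
  have := finrank_span_singleton (K := F) hx
  rw [hspan, finrank_top] at this
  omega

/-- A map which respects directions of differences and independence of pairs is additive. This is
the parallelogram construction of the sum of two vectors. -/
theorem map_add_of_sub_mem_span (hW : 2 ≤ finrank F W) {h : W → V} (h0 : h 0 = 0)
    (hsub : ∀ x y, ∃ c : F, h x - h y = c • h (x - y))
    (hind : ∀ x y, LinearIndependent F ![x, y] → LinearIndependent F ![h x, h y]) (x y : W) :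
    h (x + y) = h x + h y := by
  have key : ∀ x y, LinearIndependent F ![x, y] → h (x + y) = h x + h y := by
    intro x y hxy
    obtain ⟨c, hc⟩ := hsub (x + y) x
    obtain ⟨d, hd⟩ := hsub (x + y) y
    rw [add_sub_cancel_left] at hc
    rw [add_sub_cancel_right] at hd
    have h1 : (1 - d) • h x + (c - 1) • h y = 0 := by
      rw [sub_smul, sub_smul, ← hc, ← hd]
      module
    have h2 := (LinearIndependent.pair_iff.1 (hind x y hxy) _ _ h1).2
    rw [sub_eq_zero.1 h2, one_smul] at hc
    rw [← hc]
    abel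
  rcases eq_or_ne x 0 with rfl | hx
  · simp [h0]
  by_cases hxy : LinearIndependent F ![x, y]
  · exact key x y hxy
  -- For dependent vectors, compare the two ways of adding a vector `z` off their common line.
  rw [LinearIndependent.pair_iff' hx] at hxy
  push Not at hxy
  obtain ⟨a, rfl⟩ := hxy
  obtain ⟨z, hz⟩ := exists_linearIndependent_pair_of_two_le_finrank hW hx
  have hz' := LinearIndependent.pair_iff.1 hz
  have e1 : h (x + (a • x + z)) = h x + h (a • x + z) := by
    refine key _ _ (LinearIndependent.pair_iff.2 fun s t hst => ?_)
    have := hz' (s + t * a) t (by rw [← hst]; module)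
    refine ⟨?_, this.2⟩
    simpa [this.2] using this.1
  have add_z : ∀ b : F, h (b • x + z) = h (b • x) + h z := by
    intro b
    rcases eq_or_ne b 0 with rfl | hb
    · simp [h0]
    refine key _ _ (LinearIndependent.pair_iff.2 fun s t hst => ?_)
    have := hz' (s * b) t (by rw [← hst]; module)
    refine ⟨?_, this.2⟩
    simpa [hb] using this.1
  have e2 := add_z (1 + a)
  rw [add_smul, one_smul, add_assoc, e1, add_z a, ← add_assoc] at e2
  exact (add_right_cancel e2).symm

/-- An additive map which preserves lines and independence of pairs is semilinear with respect to
a ring endomorphism. -/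
theorem exists_ringHom_map_smul (hW : 2 ≤ finrank F W) {h : W → V}
    (hadd : ∀ x y, h (x + y) = h x + h y)
    (hline : ∀ (a : F) x, ∃ c : F, h (a • x) = c • h x)
    (hind : ∀ x y, LinearIndependent F ![x, y] → LinearIndependent F ![h x, h y]) :
    ∃ σ : F →+* F, ∀ (a : F) x, h (a • x) = σ a • h x := by
  choose τ hτ using hline
  have h0 : h 0 = 0 := by simpa using hadd 0 0
  have indep_eq : ∀ a x y, LinearIndependent F ![x, y] → τ a x = τ a y := by
    intro a x y hxy
    have e := hτ a (x + y)
    rw [smul_add, hadd, hadd, hτ, hτ] at e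
    have := LinearIndependent.pair_iff.1 (hind x y hxy) (τ a x - τ a (x + y))
      (τ a y - τ a (x + y)) (by rw [sub_smul, sub_smul, ← sub_eq_zero.2 e]; module)
    rw [sub_eq_zero.1 this.1, sub_eq_zero.1 this.2]
  have : Nontrivial W := Module.nontrivial_of_finrank_pos (R := F) (by omega)
  obtain ⟨e, he⟩ := exists_ne (0 : W)
  obtain ⟨z, hz⟩ := exists_linearIndependent_pair_of_two_le_finrank hW he
  have hhe : h e ≠ 0 := (hind e z hz).ne_zero 0
  have eq_e : ∀ a x, x ≠ 0 → τ a x = τ a e := by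
    intro a x hx
    by_cases hex : LinearIndependent F ![e, x]
    · exact (indep_eq a e x hex).symm
    · rw [LinearIndependent.pair_iff' he] at hex
      push Not at hex
      obtain ⟨b, rfl⟩ := hex
      have hb : b ≠ 0 := by rintro rfl; simp at hx
      rw [indep_eq a e z hz]
      refine indep_eq a _ _ (LinearIndependent.pair_iff.2 fun s t hst => ?_)
      have := LinearIndependent.pair_iff.1 hz (s * b) t (by rw [← hst]; module)
      exact ⟨by simpa [hb] using this.1, this.2⟩
  have hsm : ∀ (a : F) x, h (a • x) = τ a e • h x := by
    intro a x
    rcases eq_or_ne x 0 with rfl | hx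
    · simp [h0]
    · rw [hτ, eq_e a x hx]
  have inj : ∀ c d : F, c • h e = d • h e → c = d := fun c d hcd => smul_left_injective F hhe hcd
  refine ⟨{ toFun := fun a => τ a e, map_one' := ?_, map_mul' := ?_, map_zero' := ?_,
            map_add' := ?_ }, hsm⟩
  · exact inj _ _ (by rw [← hsm]; simp)
  · intro a b
    exact inj _ _ (by rw [← hsm, mul_smul, mul_smul, hsm, hsm])
  · exact inj _ _ (by rw [← hsm]; simp [h0])
  · intro a b
    exact inj _ _ (by rw [← hsm, add_smul, add_smul, hadd, hsm, hsm])

variable (F) in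
/-- A collineation of the projective space of `V`, given by a choice `γ` of representatives: the
point spanned by `x` goes to the point spanned by `γ x`. Since `γ 0 = 0`, the condition `mem_pair`
also says that `γ` is injective on points and that only `0` goes to `0`. -/
structure IsCollineationMap (γ : V → V) : Prop where
  zero : γ 0 = 0
  mem_pair : ∀ x y z, γ x ∈ span F {γ y, γ z} ↔ x ∈ span F {y, z}
  surj : ∀ w, ∃ (v : V) (c : F), w = c • γ v

namespace IsCollineationMap

variable {γ : V → V}

theorem mem_span_singleton_iff (hγ : IsCollineationMap F γ) (x y : V) :
    γ x ∈ span F {γ y} ↔ x ∈ span F {y} := by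
  simpa using hγ.mem_pair x y y

theorem eq_zero_iff (hγ : IsCollineationMap F γ) (x : V) : γ x = 0 ↔ x = 0 := by
  simpa [hγ.zero] using hγ.mem_span_singleton_iff x 0

theorem mem_of_mem_span_pair {x y z : V} {H : Submodule F V} (h : x ∈ span F {y, z})
    (hy : y ∈ H) (hz : z ∈ H) : x ∈ H :=
  span_le.2 (Set.insert_subset hy (Set.singleton_subset_iff.2 hz)) h

/-- The image of a subspace under a collineation. -/
def mapSubmodule (hγ : IsCollineationMap F γ) (H : Submodule F V) : Submodule F V where
  carrier := {w | ∃ x ∈ H, ∃ c : F, w = c • γ x}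
  zero_mem' := ⟨0, H.zero_mem, 0, by simp⟩
  smul_mem' := by
    rintro a _ ⟨x, hx, c, rfl⟩
    exact ⟨x, hx, a * c, by rw [mul_smul]⟩
  add_mem' := by
    rintro _ _ ⟨x, hx, a, rfl⟩ ⟨y, hy, b, rfl⟩
    obtain ⟨v, c, hv⟩ := hγ.surj (a • γ x + b • γ y)
    rcases eq_or_ne c 0 with rfl | hc
    · exact ⟨0, H.zero_mem, 0, by rw [hv]; simp⟩
    refine ⟨v, mem_of_mem_span_pair ((hγ.mem_pair v x y).1 ?_) hx hy, c, hv⟩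
    exact mem_span_pair.2 ⟨c⁻¹ * a, c⁻¹ * b, by
      rw [mul_smul, mul_smul, ← smul_add, hv, smul_smul, inv_mul_cancel₀ hc, one_smul]⟩

theorem map_mem_mapSubmodule (hγ : IsCollineationMap F γ) {H : Submodule F V} {x : V} :
    γ x ∈ hγ.mapSubmodule H ↔ x ∈ H := by
  constructor
  · rintro ⟨y, hy, c, hc⟩
    have : γ x ∈ span F {γ y} := mem_span_singleton.2 ⟨c, hc.symm⟩
    exact (span_singleton_le_iff_mem y H).2 hy ((hγ.mem_span_singleton_iff x y).1 this)
  · exact fun h => ⟨x, h, 1, by simp⟩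

variable {H : Submodule F V} {e : V}

/-- The affine chart of a collineation on the complement of the hyperplane `H`: the point spanned
by `e + x` goes to the point spanned by `γ e + h x`. -/
theorem exists_chart (hγ : IsCollineationMap F γ) (he : e ∉ H) :
    ∃ h : H → V, ∀ x, h x ∈ hγ.mapSubmodule H ∧
      ∃ c : F, c ≠ 0 ∧ γ (e + x) = c • (γ e + h x) := by
  have ex : ∀ x : H, ∃ y, y ∈ hγ.mapSubmodule H ∧
      ∃ c : F, c ≠ 0 ∧ γ (e + x) = c • (γ e + y) := by
    intro x
    have hpair : γ (e + x) ∈ span F {γ e, γ x} :=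
      (hγ.mem_pair _ _ _).2 (mem_span_pair.2 ⟨1, 1, by simp⟩)
    obtain ⟨a, b, hab⟩ := mem_span_pair.1 hpair
    have ha : a ≠ 0 := by
      rintro rfl
      have : γ (e + x) ∈ hγ.mapSubmodule H := ⟨x, x.2, b, by rw [← hab]; simp⟩
      exact he ((H.add_mem_iff_left x.2).1 (hγ.map_mem_mapSubmodule.1 this))
    refine ⟨(a⁻¹ * b) • γ x, ⟨x, x.2, _, rfl⟩, a, ha, ?_⟩
    rw [← hab, smul_add, smul_smul, mul_inv_cancel_left₀ ha]
  choose h hh using ex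
  exact ⟨h, hh⟩

theorem coeff_eq_zero {H : Submodule F V} {e y : V} (he : e ∉ H) (hy : y ∈ H) {c : F}
    (h : c • e + y ∈ H) : c = 0 := by
  by_contra hc
  exact he ((H.smul_mem_iff hc).1 ((H.add_mem_iff_left hy).1 h))

variable [FiniteDimensional F V]

/-- The fundamental theorem of projective geometry: a collineation of a projective space of
dimension at least two is induced by a semilinear bijection. -/
theorem exists_semilinear (hγ : IsCollineationMap F γ) (hV : 3 ≤ finrank F V) :
    ∃ (σ : F ≃+* F) (u : V →ₛₗ[(σ : F →+* F)] V),
      Function.Bijective u ∧ ∀ v, γ v ∈ span F {u v} := by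
  have : Nontrivial V := Module.nontrivial_of_finrank_pos (R := F) (by omega)
  obtain ⟨e, he0⟩ := exists_ne (0 : V)
  obtain ⟨H, hcompl⟩ := Submodule.exists_isCompl (span F {e})
  have heH : e ∉ H := fun h => he0 (by
    simpa using hcompl.disjoint.le_bot
      (show e ∈ span F {e} ⊓ H from ⟨mem_span_singleton_self e, h⟩))
  have hHfin : 2 ≤ finrank F H := by
    have h1 := Submodule.finrank_add_eq_of_isCompl hcompl
    rw [finrank_span_singleton he0] at h1
    omega
  set H' := hγ.mapSubmodule H with hH'
  have heH' : γ e ∉ H' := fun h => heH (hγ.map_mem_mapSubmodule.1 h)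
  obtain ⟨h, hh⟩ := hγ.exists_chart heH
  have hmem : ∀ x, h x ∈ H' := fun x => (hh x).1
  have h0 : h 0 = 0 := by
    obtain ⟨-, c, hc, hc'⟩ := hh 0
    rw [ZeroMemClass.coe_zero, add_zero, smul_add] at hc'
    have h1 : c - 1 = 0 := by
      refine coeff_eq_zero heH' (H'.smul_mem c (hmem 0)) ?_
      have : (c - 1) • γ e + c • h 0 = 0 := by
        rw [sub_smul, one_smul]
        nth_rewrite 2 [hc']
        abel
      rw [this]
      exact H'.zero_mem
    rw [sub_eq_zero.1 h1, one_smul, one_smul] at hc'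
    simpa using hc'
  -- The direction of a line through two affine points is its point at infinity.
  have hdiff : ∀ x y : H, ∃ c : F, γ ((x - y : H) : V) = c • (h x - h y) := by
    intro x y
    obtain ⟨-, a, ha, hax⟩ := hh x
    obtain ⟨-, b, hb, hby⟩ := hh y
    have hp : γ ((x - y : H) : V) ∈ span F {γ (e + x), γ (e + y)} :=
      (hγ.mem_pair _ _ _).2 (mem_span_pair.2 ⟨1, -1, by push_cast; module⟩)
    obtain ⟨s, t, hst⟩ := mem_span_pair.1 hp
    rw [hax, hby] at hst
    have hst' : (s * a + t * b) • γ e + ((s * a) • h x + (t * b) • h y) = γ ((x - y : H) : V) := by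
      rw [← hst]; module
    have hz : s * a + t * b = 0 := coeff_eq_zero heH'
      (H'.add_mem (H'.smul_mem _ (hmem x)) (H'.smul_mem _ (hmem y)))
      (by rw [hst']; exact hγ.map_mem_mapSubmodule.2 (x - y : H).2)
    refine ⟨s * a, ?_⟩
    rw [← hst', hz, eq_neg_of_add_eq_zero_right hz]
    module
  have hγh : ∀ x : H, ∃ c : F, γ (x : V) = c • h x := by
    intro x
    simpa [h0] using hdiff x 0
  have hhγ : ∀ x : H, ∃ c : F, h x = c • γ (x : V) := by
    intro x
    obtain ⟨c, hc⟩ := hγh x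
    rcases eq_or_ne c 0 with rfl | hc0
    · rw [zero_smul, hγ.eq_zero_iff, ZeroMemClass.coe_eq_zero] at hc
      exact ⟨0, by simp [hc, h0]⟩
    · exact ⟨c⁻¹, by rw [hc, smul_smul, inv_mul_cancel₀ hc0, one_smul]⟩
  have hsub : ∀ x y, ∃ c : F, h x - h y = c • h (x - y) := by
    intro x y
    obtain ⟨c, hc⟩ := hdiff x y
    rcases eq_or_ne c 0 with rfl | hc0
    · rw [zero_smul, hγ.eq_zero_iff, ZeroMemClass.coe_eq_zero, sub_eq_zero] at hc
      exact ⟨0, by simp [hc]⟩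
    · obtain ⟨d, hd⟩ := hγh (x - y)
      exact ⟨c⁻¹ * d, by rw [mul_smul, ← hd, hc, smul_smul, inv_mul_cancel₀ hc0, one_smul]⟩
  have hhzero : ∀ x, h x = 0 → x = 0 := by
    intro x hx
    obtain ⟨c, hc⟩ := hγh x
    rw [hx, smul_zero, hγ.eq_zero_iff, ZeroMemClass.coe_eq_zero] at hc
    exact hc
  have hline' : ∀ x y : H, x ≠ 0 → ∀ c : F, c • h x = h y → ∃ d : F, d • x = y := by
    intro x y hx c hc
    obtain ⟨s, hs⟩ := hhγ x
    obtain ⟨t, ht⟩ := hγh y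
    have : γ (y : V) ∈ span F {γ (x : V)} := by
      rw [ht, ← hc, hs]
      exact smul_mem _ _ (smul_mem _ _ (smul_mem _ _ (mem_span_singleton_self _)))
    obtain ⟨d, hd⟩ := mem_span_singleton.1 ((hγ.mem_span_singleton_iff _ _).1 this)
    exact ⟨d, Subtype.ext hd⟩
  have hind : ∀ x y, LinearIndependent F ![x, y] → LinearIndependent F ![h x, h y] := by
    intro x y hxy
    have hx : x ≠ 0 := hxy.ne_zero 0
    have hx' : h x ≠ 0 := fun h' => hx (hhzero x h')
    rw [LinearIndependent.pair_iff' hx] at hxy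
    rw [LinearIndependent.pair_iff' hx']
    intro c hc
    obtain ⟨d, hd⟩ := hline' x y hx c hc
    exact hxy d hd
  have hadd := map_add_of_sub_mem_span hHfin h0 hsub hind
  have hline : ∀ (a : F) x, ∃ c : F, h (a • x) = c • h x := by
    intro a x
    obtain ⟨s, hs⟩ := hhγ (a • x)
    obtain ⟨t, ht⟩ := hγh x
    have : γ ((a • x : H) : V) ∈ span F {γ (x : V)} :=
      (hγ.mem_span_singleton_iff _ _).2 (mem_span_singleton.2 ⟨a, rfl⟩)
    obtain ⟨d, hd⟩ := mem_span_singleton.1 this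
    exact ⟨s * d * t, by rw [hs, ← hd, ht]; module⟩
  obtain ⟨σ, hσ⟩ := exists_ringHom_map_smul hHfin hadd hline hind
  have hdecomp : ∀ v : V, ∃ (a : F) (z : H), v = a • e + z := by
    intro v
    have hv : v ∈ span F {e} ⊔ H := by rw [hcompl.sup_eq_top]; trivial
    obtain ⟨y, hy, z, hz, rfl⟩ := mem_sup.1 hv
    obtain ⟨a, rfl⟩ := mem_span_singleton.1 hy
    exact ⟨a, ⟨z, hz⟩, rfl⟩
  have hγaff : ∀ (a : F) (z : H), a ≠ 0 → γ (a • e + z) ∈ span F {γ e + h (a⁻¹ • z)} := by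
    intro a z ha
    have h1 : γ (a • e + z) ∈ span F {γ (e + (a⁻¹ • z : H))} :=
      (hγ.mem_span_singleton_iff _ _).2 (mem_span_singleton.2 ⟨a, by
        rw [smul_add, coe_smul, smul_smul, mul_inv_cancel₀ ha, one_smul]⟩)
    obtain ⟨-, c, -, hc⟩ := hh (a⁻¹ • z)
    rw [hc] at h1
    exact (span_singleton_le_iff_mem _ _).2
      (smul_mem _ _ (mem_span_singleton_self _)) h1
  have hσsurj : Function.Surjective σ := by
    intro b
    have : Nontrivial H := Module.nontrivial_of_finrank_pos (R := F) (by omega)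
    obtain ⟨x, hx⟩ := exists_ne (0 : H)
    have hx' : h x ≠ 0 := fun h' => hx (hhzero x h')
    obtain ⟨v, c, hv⟩ := hγ.surj (γ e + b • h x)
    obtain ⟨a, z, rfl⟩ := hdecomp v
    have ha : a ≠ 0 := by
      rintro rfl
      refine heH' ((H'.add_mem_iff_left (H'.smul_mem b (hmem x))).1 ?_)
      rw [hv]
      exact H'.smul_mem _ (hγ.map_mem_mapSubmodule.2 (by simp))
    obtain ⟨d, hd⟩ := mem_span_singleton.1 (hγaff a z ha)
    rw [← hd, smul_smul, smul_add] at hv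
    have h1 : c * d - 1 = 0 := by
      refine coeff_eq_zero heH' (H'.smul_mem (c * d) (hmem (a⁻¹ • z))) ?_
      have : (c * d - 1) • γ e + (c * d) • h (a⁻¹ • z) = b • h x := by
        rw [sub_smul, one_smul, sub_add_eq_add_sub, ← hv, add_sub_cancel_left]
      rw [this]
      exact H'.smul_mem _ (hmem x)
    rw [sub_eq_zero.1 h1, one_smul, one_smul, add_right_inj] at hv
    obtain ⟨t, ht⟩ := hline' x _ hx b hv
    rw [← ht, hσ] at hv
    exact ⟨t, (smul_left_injective F hx' hv).symm⟩
  choose a z haz using hdecomp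
  have huniq : ∀ (c : F) (y : H) v, v = c • e + y → a v = c ∧ z v = y := by
    intro c y v hv
    have h1 : a v - c = 0 := by
      refine coeff_eq_zero heH (z v).2 ?_
      have : (a v - c) • e + (z v : V) = y := by
        rw [sub_smul, sub_add_eq_add_sub, ← haz, hv, add_sub_cancel_left]
      rw [this]
      exact y.2
    have h2 : a v = c := sub_eq_zero.1 h1
    refine ⟨h2, Subtype.ext ?_⟩
    have := haz v
    rw [h2] at this
    exact add_left_cancel (this.symm.trans hv)
  let τ : F ≃+* F := RingEquiv.ofBijective σ ⟨σ.injective, hσsurj⟩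
  have hτ : ∀ c, τ c = σ c := fun _ => rfl
  let u : V →ₛₗ[(τ : F →+* F)] V :=
    { toFun := fun v => σ (a v) • γ e + h (z v)
      map_add' := by
        intro v w
        obtain ⟨h1, h2⟩ := huniq (a v + a w) (z v + z w) (v + w) (by
          rw [coe_add, add_smul]
          nth_rewrite 1 [haz v, haz w]
          abel)
        rw [h1, h2, map_add, hadd, add_smul]
        abel
      map_smul' := by
        intro c v
        obtain ⟨h1, h2⟩ := huniq (c * a v) (c • z v) (c • v) (by
          rw [coe_smul, mul_smul, ← smul_add, ← haz])
        rw [h1, h2, map_mul, hσ, mul_smul, ← smul_add]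
        rfl }
  have hu : ∀ v, u v = σ (a v) • γ e + h (z v) := fun _ => rfl
  have hγu : ∀ v, γ v ∈ span F {u v} := by
    intro v
    rw [hu]
    by_cases hav : a v = 0
    · obtain ⟨c, hc⟩ := hγh (z v)
      have hv := haz v
      rw [hav, zero_smul, zero_add] at hv
      rw [hav, map_zero, zero_smul, zero_add, mem_span_singleton]
      exact ⟨c, by rw [← hc, ← hv]⟩
    · have h1 := hγaff _ (z v) hav
      rw [← haz] at h1
      refine (span_singleton_le_iff_mem _ _).2 (mem_span_singleton.2 ⟨(σ (a v))⁻¹, ?_⟩) h1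
      rw [hσ, smul_add, smul_smul, inv_mul_cancel₀ (by simpa using hav), one_smul, map_inv₀]
  refine ⟨τ, u, ⟨(injective_iff_map_eq_zero u).2 fun v hv => ?_, fun w => ?_⟩, hγu⟩
  · have := hγu v
    rw [hv] at this
    exact (hγ.eq_zero_iff v).1 (by simpa using this)
  · obtain ⟨v, c, rfl⟩ := hγ.surj w
    obtain ⟨d, hd⟩ := mem_span_singleton.1 (hγu v)
    obtain ⟨t, ht⟩ := hσsurj (c * d)
    exact ⟨t • v, by rw [u.map_smulₛₗ, ← hd, smul_smul, ← ht]; rfl⟩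

end IsCollineationMap

end Collineation

/-! ### Adjacent planes, stars and tops -/

section Adjacency

open Module (finrank)
open Submodule

variable {F V : Type*} [Field F] [AddCommGroup V] [Module F V] [FiniteDimensional F V]

theorem exists_finrank_eq_between {N M : Submodule F V} (hNM : N ≤ M) {m : ℕ}
    (h1 : finrank F N ≤ m) (h2 : m ≤ finrank F M) :
    ∃ W : Submodule F V, N ≤ W ∧ W ≤ M ∧ finrank F W = m := by
  induction m, h1 using Nat.le_induction with
  | base => exact ⟨N, le_rfl, hNM, rfl⟩
  | succ m hm ih =>
    obtain ⟨W, hNW, hWM, hW⟩ := ih (by omega)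
    have hlt : W < M := lt_of_le_of_ne hWM (by rintro rfl; omega)
    obtain ⟨v, hvM, hvW⟩ := SetLike.exists_of_lt hlt
    refine ⟨W ⊔ span F {v}, hNW.trans le_sup_left,
      sup_le hWM ((span_singleton_le_iff_mem _ _).2 hvM), ?_⟩
    rw [finrank_sup_span_singleton hvW, hW]

theorem exists_between_not_le {N M K : Submodule F V} (hNM : N ≤ M) {m : ℕ}
    (h1 : finrank F N + 1 ≤ m) (h2 : m ≤ finrank F M) (hK : ¬ M ≤ K) :
    ∃ W : Submodule F V, N ≤ W ∧ W ≤ M ∧ finrank F W = m ∧ ¬ W ≤ K := by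
  obtain ⟨v, hvM, hvK⟩ := SetLike.not_le_iff_exists.1 hK
  have hle : N ⊔ span F {v} ≤ M := sup_le hNM ((span_singleton_le_iff_mem _ _).2 hvM)
  have hfin : finrank F (N ⊔ span F {v} : Submodule F V) ≤ finrank F N + 1 := by
    by_cases hv : v ∈ N
    · rw [sup_eq_left.2 ((span_singleton_le_iff_mem _ _).2 hv)]
      omega
    · rw [finrank_sup_span_singleton hv]
  obtain ⟨W, hW1, hW2, hW3⟩ := exists_finrank_eq_between hle (hfin.trans h1) h2
  refine ⟨W, le_sup_left.trans hW1, hW2, hW3, fun h => hvK (h (hW1 ?_))⟩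
  exact mem_sup_right (mem_span_singleton_self v)

theorem not_le_of_finrank_lt {N M : Submodule F V} (h : finrank F N < finrank F M) : ¬ M ≤ N :=
  fun h' => absurd (finrank_mono h') (by omega)

variable {k j : ℕ}

theorem Grassmannian.eq_of_le {s t : Grassmannian F V k} (h : s.1 ≤ t.1) : s = t :=
  Subtype.ext (eq_of_le_of_finrank_eq h (s.2.trans t.2.symm))

theorem finrank_inf_lt_of_ne {s t : Grassmannian F V k} (h : s ≠ t) :
    finrank F (s.1 ⊓ t.1 : Submodule F V) < k := by
  have h1 : finrank F (s.1 ⊓ t.1 : Submodule F V) ≤ k := by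
    exact (finrank_mono inf_le_left).trans s.2.le
  refine lt_of_le_of_ne h1 fun he => h (Grassmannian.eq_of_le ?_)
  exact inf_eq_left.1 (eq_of_le_of_finrank_eq inf_le_left (he.trans s.2.symm))

theorem inf_eq_of_le_of_ne {N : Grassmannian F V j} {s t : Grassmannian F V (j + 1)} (h : s ≠ t)
    (hs : N.1 ≤ s.1) (ht : N.1 ≤ t.1) : s.1 ⊓ t.1 = N.1 := by
  refine (eq_of_le_of_finrank_le (le_inf hs ht) ?_).symm
  have := finrank_inf_lt_of_ne h
  rw [N.2]
  omega

theorem finrank_sup_of_inf {s t : Grassmannian F V (j + 1)}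
    (h : finrank F (s.1 ⊓ t.1 : Submodule F V) = j) :
    finrank F (s.1 ⊔ t.1 : Submodule F V) = j + 2 := by
  have := finrank_sup_add_finrank_inf_eq s.1 t.1
  rw [h, s.2, t.2] at this
  omega

theorem finrank_inf_eq_of_le_of_ne {M : Submodule F V} (hM : finrank F M = j + 2)
    {s t : Grassmannian F V (j + 1)} (h : s ≠ t) (hs : s.1 ≤ M) (ht : t.1 ≤ M) :
    finrank F (s.1 ⊓ t.1 : Submodule F V) = j := by
  have h1 := finrank_sup_add_finrank_inf_eq s.1 t.1
  have h2 := finrank_inf_lt_of_ne h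
  have h3 := finrank_mono (sup_le hs ht)
  rw [s.2, t.2] at h1
  omega

/-- Three pairwise adjacent planes: if the third is not contained in the span of the other two,
all three share a common subspace of codimension one. -/
theorem inf_le_of_not_le_sup {s t u : Grassmannian F V (j + 1)}
    (hsu : finrank F (s.1 ⊓ u.1 : Submodule F V) = j)
    (htu : finrank F (t.1 ⊓ u.1 : Submodule F V) = j)
    (hst : finrank F (s.1 ⊓ t.1 : Submodule F V) = j) (h : ¬ u.1 ≤ s.1 ⊔ t.1) :
    s.1 ⊓ t.1 ≤ u.1 := by
  have hlt : finrank F (u.1 ⊓ (s.1 ⊔ t.1) : Submodule F V) < j + 1 := by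
    exact (finrank_lt_finrank_of_lt (lt_of_le_of_ne inf_le_left
      fun h' => h (inf_eq_left.1 h'))).trans_eq u.2
  have e1 : s.1 ⊓ u.1 = u.1 ⊓ (s.1 ⊔ t.1) := eq_of_le_of_finrank_le
    (le_inf inf_le_right (inf_le_left.trans le_sup_left)) (by omega)
  have e2 : t.1 ⊓ u.1 = u.1 ⊓ (s.1 ⊔ t.1) := eq_of_le_of_finrank_le
    (le_inf inf_le_right (inf_le_left.trans le_sup_right)) (by omega)
  have e3 : s.1 ⊓ u.1 ≤ s.1 ⊓ t.1 := le_inf inf_le_left (by rw [e1, ← e2]; exact inf_le_left)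
  rw [← eq_of_le_of_finrank_eq e3 (hsu.trans hst.symm)]
  exact inf_le_right

/-- A family of pairwise adjacent planes lies in a star (all planes through a common subspace `N`
of codimension one) or in a top (all planes inside a common subspace `M` of one dimension more). -/
theorem exists_star_or_top_of_pairwise {X : Set (Grassmannian F V (j + 1))} (hX : X.Nontrivial)
    (hadj : ∀ s ∈ X, ∀ t ∈ X, s ≠ t → finrank F (s.1 ⊓ t.1 : Submodule F V) = j) :
    (∃ N : Grassmannian F V j, ∀ s ∈ X, N.1 ≤ s.1) ∨
      ∃ M : Grassmannian F V (j + 2), ∀ s ∈ X, s.1 ≤ M.1 := by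
  obtain ⟨s, hs, t, ht, hne⟩ := hX
  have hst := hadj s hs t ht hne
  have trip : ∀ s ∈ X, ∀ t ∈ X, s ≠ t → ∀ u ∈ X, ¬ u.1 ≤ s.1 ⊔ t.1 → s.1 ⊓ t.1 ≤ u.1 := by
    intro s hs t ht hne u hu hle
    refine inf_le_of_not_le_sup (hadj s hs u hu ?_) (hadj t ht u hu ?_) (hadj s hs t ht hne) hle
    · rintro rfl
      exact hle le_sup_left
    · rintro rfl
      exact hle le_sup_right
  by_cases htop : ∀ u ∈ X, u.1 ≤ s.1 ⊔ t.1
  · exact Or.inr ⟨⟨_, finrank_sup_of_inf hst⟩, htop⟩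
  push Not at htop
  obtain ⟨u, hu, hul⟩ := htop
  refine Or.inl ⟨⟨_, hst⟩, fun v hv => ?_⟩
  by_cases hv1 : v.1 ≤ s.1 ⊔ t.1
  · have hsu : s ≠ u := by rintro rfl; exact hul le_sup_left
    by_cases hv2 : v.1 ≤ s.1 ⊔ u.1
    · have hle : s.1 ≤ (s.1 ⊔ t.1) ⊓ (s.1 ⊔ u.1) := le_inf le_sup_left le_sup_left
      have hlt : (s.1 ⊔ t.1) ⊓ (s.1 ⊔ u.1) < s.1 ⊔ u.1 :=
        lt_of_le_of_ne inf_le_right fun h => hul (le_sup_right.trans (inf_eq_right.1 h))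
      have h1 := finrank_lt_finrank_of_lt hlt
      rw [finrank_sup_of_inf (hadj s hs u hu hsu)] at h1
      have h2 := eq_of_le_of_finrank_le hle (by rw [s.2]; omega)
      have h3 : v.1 ≤ s.1 := by rw [h2]; exact le_inf hv1 hv2
      rw [Grassmannian.eq_of_le h3]
      exact inf_le_left
    · have h1 := trip s hs u hu hsu v hv hv2
      have h2 : s.1 ⊓ t.1 ≤ s.1 ⊓ u.1 := le_inf inf_le_left (trip s hs t ht hne u hu hul)
      exact h2.trans h1
  · exact trip s hs t ht hne v hv hv1

theorem exists_pair_between {N : Grassmannian F V j} {M : Submodule F V} (hNM : N.1 ≤ M)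
    (hM : j + 2 ≤ finrank F M) : ∃ s t : Grassmannian F V (j + 1),
      s ≠ t ∧ N.1 ≤ s.1 ∧ N.1 ≤ t.1 ∧ s.1 ≤ M ∧ t.1 ≤ M := by
  obtain ⟨s, hs1, hs2, hs3⟩ := exists_finrank_eq_between hNM (m := j + 1) (by rw [N.2]; omega)
    (by omega)
  obtain ⟨t, ht1, ht2, ht3, ht4⟩ := exists_between_not_le hNM (m := j + 1) (by rw [N.2]) (by omega)
    (K := s) (not_le_of_finrank_lt (by omega))
  refine ⟨⟨s, hs3⟩, ⟨t, ht3⟩, ?_, hs1, ht1, hs2, ht2⟩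
  intro h
  exact ht4 (congrArg Subtype.val h).ge

theorem exists_pair_inf_eq (N : Grassmannian F V j) (hj : j + 2 ≤ finrank F V) :
    ∃ s t : Grassmannian F V (j + 1), s ≠ t ∧ s.1 ⊓ t.1 = N.1 := by
  obtain ⟨s, t, hne, hs, ht, -, -⟩ := exists_pair_between (le_top : N.1 ≤ ⊤)
    (by rwa [finrank_top])
  exact ⟨s, t, hne, inf_eq_of_le_of_ne hne hs ht⟩

/-- A star determines its centre. -/
theorem eq_of_star_subset_star {N N' : Grassmannian F V j} (hj : j + 2 ≤ finrank F V)
    (h : ∀ s : Grassmannian F V (j + 1), N.1 ≤ s.1 → N'.1 ≤ s.1) : N = N' := by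
  obtain ⟨s, t, -, hst⟩ := exists_pair_inf_eq N hj
  refine (Grassmannian.eq_of_le ?_).symm
  rw [← hst]
  exact le_inf (h s (by rw [← hst]; exact inf_le_left)) (h t (by rw [← hst]; exact inf_le_right))

theorem exists_mem_star_not_le {N : Grassmannian F V j} {M : Submodule F V} (hM : M ≠ ⊤)
    (hj : j + 1 ≤ finrank F V) : ∃ s : Grassmannian F V (j + 1), N.1 ≤ s.1 ∧ ¬ s.1 ≤ M := by
  obtain ⟨W, h1, -, h3, h4⟩ := exists_between_not_le (le_top : N.1 ≤ ⊤) (m := j + 1) (K := M)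
    (by rw [N.2]) (by rwa [finrank_top]) (by rwa [top_le_iff])
  exact ⟨⟨W, h3⟩, h1, h4⟩

omit [FiniteDimensional F V] in
theorem Grassmannian.ne_top {M : Grassmannian F V k} (h : k ≠ finrank F V) : M.1 ≠ ⊤ := by
  intro h'
  have := M.2
  rw [h', finrank_top] at this
  exact h this.symm

/-- `f` preserves adjacency of planes in both directions. -/
def PreservesAdjacency (f : Equiv.Perm (Grassmannian F V (j + 1))) : Prop :=
  ∀ s t, finrank F (s.1 ⊓ t.1 : Submodule F V) = j ↔
    finrank F ((f s).1 ⊓ (f t).1 : Submodule F V) = j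

omit [FiniteDimensional F V] in
theorem PreservesAdjacency.symm {f : Equiv.Perm (Grassmannian F V (j + 1))}
    (hf : PreservesAdjacency f) : PreservesAdjacency f.symm := fun s t => by
  have := hf (f.symm s) (f.symm t)
  rw [f.apply_symm_apply, f.apply_symm_apply] at this
  exact this.symm

/-- `f` maps the star with centre `N` onto a star. -/
def StarToStar (f : Equiv.Perm (Grassmannian F V (j + 1))) (N : Grassmannian F V j) : Prop :=
  ∃ N' : Grassmannian F V j, ∀ s, N.1 ≤ s.1 ↔ N'.1 ≤ (f s).1

/-- `f` maps the star with centre `N` onto a top. -/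
def StarToTop (f : Equiv.Perm (Grassmannian F V (j + 1))) (N : Grassmannian F V j) : Prop :=
  ∃ M : Grassmannian F V (j + 2), ∀ s, N.1 ≤ s.1 ↔ (f s).1 ≤ M.1

variable {f : Equiv.Perm (Grassmannian F V (j + 1))}

/-- Stars are maximal families of pairwise adjacent planes, and so are tops; hence a bijection
preserving adjacency in both directions maps a star onto a star or onto a top. -/
theorem starToStar_or_starToTop (hj : j + 3 ≤ finrank F V) (hf : PreservesAdjacency f)
    (N : Grassmannian F V j) :
    StarToStar f N ∨ StarToTop f N := by
  -- The preimage of any family of pairwise adjacent planes which contains the star is the star.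
  have back : ∀ X : Set (Grassmannian F V (j + 1)),
      (∀ s ∈ X, ∀ t ∈ X, s ≠ t → finrank F (s.1 ⊓ t.1 : Submodule F V) = j) →
      (∀ s, N.1 ≤ s.1 → f s ∈ X) → ∀ s, N.1 ≤ s.1 ↔ f s ∈ X := by
    intro X hX hN
    have hnt : (f ⁻¹' X).Nontrivial := by
      obtain ⟨s, t, hne, hst⟩ := exists_pair_inf_eq N (by omega)
      exact ⟨s, hN s (by rw [← hst]; exact inf_le_left), t,
        hN t (by rw [← hst]; exact inf_le_right), hne⟩
    have hadj : ∀ s ∈ f ⁻¹' X, ∀ t ∈ f ⁻¹' X, s ≠ t →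
        finrank F (s.1 ⊓ t.1 : Submodule F V) = j := by
      intro s hs t ht hne
      exact (hf s t).2 (hX _ hs _ ht (f.injective.ne hne))
    rcases exists_star_or_top_of_pairwise hnt hadj with ⟨N', hN'⟩ | ⟨M, hM⟩
    · have : N = N' := eq_of_star_subset_star (by omega) fun s hs => hN' s (hN s hs)
      subst this
      exact fun s => ⟨hN s, hN' s⟩
    · obtain ⟨s, hs, hsM⟩ := exists_mem_star_not_le (N := N)
        (Grassmannian.ne_top (M := M) (by omega)) (by omega)
      exact absurd (hM s (hN s hs)) hsM
  have hnt : {s | N.1 ≤ (f.symm s).1}.Nontrivial := by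
    obtain ⟨s, t, hne, hst⟩ := exists_pair_inf_eq N (by omega)
    exact ⟨f s, by simp [← hst], f t, by simp [← hst], f.injective.ne hne⟩
  have hadj : ∀ s ∈ {s | N.1 ≤ (f.symm s).1}, ∀ t ∈ {s | N.1 ≤ (f.symm s).1}, s ≠ t →
      finrank F (s.1 ⊓ t.1 : Submodule F V) = j := by
    intro s hs t ht hne
    have := (hf (f.symm s) (f.symm t)).1
      (by rw [inf_eq_of_le_of_ne (f.symm.injective.ne hne) hs ht, N.2])
    rwa [f.apply_symm_apply, f.apply_symm_apply] at this
  rcases exists_star_or_top_of_pairwise hnt hadj with ⟨N', hN'⟩ | ⟨M, hM⟩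
  · refine Or.inl ⟨N', back {s | N'.1 ≤ s.1} ?_ fun s hs => hN' _ (by simpa using hs)⟩
    intro s hs t ht hne
    rw [inf_eq_of_le_of_ne hne hs ht, N'.2]
  · refine Or.inr ⟨M, back {s | s.1 ≤ M.1} ?_ fun s hs => hM _ (by simpa using hs)⟩
    exact fun s hs t ht hne => finrank_inf_eq_of_le_of_ne M.2 hne hs ht

/-- Stars with adjacent centres share exactly one plane, whereas a star and a top share none or at
least two. Hence adjacent stars do not go to families of different types. -/
theorem StarToStar.not_starToTop_of_adjacent {N N' : Grassmannian F V j} (hN : StarToStar f N)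
    (hN' : StarToTop f N') (hsup : finrank F (N.1 ⊔ N'.1 : Submodule F V) = j + 1) : False := by
  obtain ⟨K, hK⟩ := hN
  obtain ⟨M, hM⟩ := hN'
  let s : Grassmannian F V (j + 1) := ⟨_, hsup⟩
  have hKM : K.1 ≤ M.1 := ((hK s).1 le_sup_left).trans ((hM s).1 le_sup_right)
  obtain ⟨t, u, hne, ht, hu, ht', hu'⟩ := exists_pair_between hKM M.2.ge
  have key : ∀ t : Grassmannian F V (j + 1), K.1 ≤ t.1 → t.1 ≤ M.1 → f s = t := by
    intro t ht ht'
    have h1 := (hK (f.symm t)).2 (by simpa using ht)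
    have h2 := (hM (f.symm t)).2 (by simpa using ht')
    have h3 : s = f.symm t := Grassmannian.eq_of_le (sup_le h1 h2)
    rw [h3, Equiv.apply_symm_apply]
  exact hne ((key t ht ht').symm.trans (key u hu hu'))

/-- The graph of adjacency on the planes of a fixed dimension is connected. -/
theorem induction_adjacent {P : Grassmannian F V j → Prop}
    (hP : ∀ N N' : Grassmannian F V j, finrank F (N.1 ⊔ N'.1 : Submodule F V) = j + 1 →
      P N → P N') (N N' : Grassmannian F V j) (hN : P N) : P N' := by
  obtain ⟨d, hd⟩ : ∃ d, j ≤ finrank F (N.1 ⊓ N'.1 : Submodule F V) + d := ⟨j, by omega⟩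
  induction d generalizing N with
  | zero =>
    rcases eq_or_ne N N' with rfl | hne
    · exact hN
    · exact absurd (finrank_inf_lt_of_ne hne) (by omega)
  | succ d ih =>
    rcases eq_or_ne N N' with rfl | hne
    · exact hN
    -- Exchange one dimension of `N` for a vector of `N'`.
    have hlt := finrank_inf_lt_of_ne hne
    obtain ⟨K, hK1, hK2, hK3⟩ := exists_finrank_eq_between (inf_le_left : N.1 ⊓ N'.1 ≤ N.1)
      (m := j - 1) (by omega) (by rw [N.2]; omega)
    have hnle : ¬ N'.1 ≤ N.1 := fun h => hne (Grassmannian.eq_of_le h).symm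
    obtain ⟨v, hv', hv⟩ := SetLike.not_le_iff_exists.1 hnle
    have hL : finrank F (K ⊔ span F {v} : Submodule F V) = j := by
      rw [finrank_sup_span_singleton fun h => hv (hK2 h), hK3]
      omega
    refine ih ⟨_, hL⟩ (hP N _ ?_ hN) ?_
    · rw [show N.1 ⊔ (K ⊔ span F {v}) = N.1 ⊔ span F {v} by
        rw [← sup_assoc, sup_eq_left.2 hK2], finrank_sup_span_singleton hv, N.2]
    · have hle : (N.1 ⊓ N'.1) ⊔ span F {v} ≤ (K ⊔ span F {v}) ⊓ N'.1 :=
        le_inf (sup_le_sup_right hK1 _)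
          (sup_le inf_le_right ((span_singleton_le_iff_mem _ _).2 hv'))
      have h1 := finrank_mono hle
      rw [finrank_sup_span_singleton fun h => hv (mem_inf.1 h).1] at h1
      change j ≤ finrank F ((K ⊔ span F {v}) ⊓ N'.1 : Submodule F V) + d
      omega

end Adjacency

/-! ### From incidence to semilinear maps -/

section Incidence

open Module (finrank)
open Submodule

variable {F V : Type*} [Field F] [AddCommGroup V] [Module F V]

/-- The point of the projective space spanned by a nonzero vector. -/
def spanPoint {v : V} (hv : v ≠ 0) : Grassmannian F V 1 :=
  ⟨span F {v}, finrank_span_singleton hv⟩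

variable [FiniteDimensional F V]

theorem exists_eq_spanPoint (p : Grassmannian F V 1) :
    ∃ (v : V) (hv : v ≠ 0), p = spanPoint hv := by
  have : p.1 ≠ ⊥ := fun h => by
    have := p.2
    rw [h, finrank_bot] at this
    omega
  obtain ⟨v, hvp, hv⟩ := p.1.ne_bot_iff.1 this
  refine ⟨v, hv, (Grassmannian.eq_of_le ?_).symm⟩
  exact (span_singleton_le_iff_mem v p.1).2 hvp

/-- A permutation of the points preserving collinearity is induced by a semilinear bijection. -/
theorem mem_linearTransformations_of_collinear (hV : 3 ≤ finrank F V)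
    {g : Equiv.Perm (Grassmannian F V 1)}
    (hg : ∀ p q r : Grassmannian F V 1, p.1 ≤ q.1 ⊔ r.1 ↔ (g p).1 ≤ (g q).1 ⊔ (g r).1) :
    g ∈ linearTransformations F V 1 := by
  have ex : ∀ v : V, ∃ w : V, (v = 0 → w = 0) ∧
      ∀ hv : v ≠ 0, (g (spanPoint hv)).1 = span F {w} := by
    intro v
    rcases eq_or_ne v 0 with rfl | hv
    · exact ⟨0, fun _ => rfl, fun h => absurd rfl h⟩
    · obtain ⟨w, hw, h⟩ := exists_eq_spanPoint (g (spanPoint (F := F) hv))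
      exact ⟨w, fun h => absurd h hv, fun _ => congrArg Subtype.val h⟩
  choose γ hγ0 hγ using ex
  have hpair : ∀ x y : V, span F {x, y} = span F {x} ⊔ span F {y} := fun x y => span_insert x {y}
  have hsingle : ∀ p q : Grassmannian F V 1, p.1 ≤ q.1 ↔ (g p).1 ≤ (g q).1 := by
    intro p q
    simpa using hg p q q
  have hcol : IsCollineationMap F γ := by
    refine ⟨hγ0 0 rfl, fun x y z => ?_, fun w => ?_⟩
    · rw [hpair, hpair, ← span_singleton_le_iff_mem, ← span_singleton_le_iff_mem]
      rcases eq_or_ne x 0 with rfl | hx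
      · simp [hγ0 0 rfl]
      have hxne : ¬ (g (spanPoint (F := F) hx)).1 ≤ ⊥ := fun h => by
        have := (g (spanPoint (F := F) hx)).2
        rw [le_bot_iff.1 h, finrank_bot] at this
        omega
      rcases eq_or_ne y 0 with rfl | hy <;> rcases eq_or_ne z 0 with rfl | hz
      · rw [hγ x hx] at hxne
        simpa [hγ0 0 rfl, hx] using hxne
      · rw [hγ0 0 rfl, span_zero_singleton, bot_sup_eq, bot_sup_eq, ← hγ x hx, ← hγ z hz]
        exact (hsingle _ _).symm
      · rw [hγ0 0 rfl, span_zero_singleton, sup_bot_eq, sup_bot_eq, ← hγ x hx, ← hγ y hy]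
        exact (hsingle _ _).symm
      · rw [← hγ x hx, ← hγ y hy, ← hγ z hz]
        exact (hg _ _ _).symm
    · rcases eq_or_ne w 0 with rfl | hw
      · exact ⟨0, 0, by simp⟩
      · obtain ⟨v, hv, h⟩ := exists_eq_spanPoint (g.symm (spanPoint (F := F) hw))
        rw [Equiv.symm_apply_eq] at h
        have h1 : span F {w} = span F {γ v} := by
          rw [← hγ v hv, ← h]
          rfl
        obtain ⟨c, hc⟩ := mem_span_singleton.1 (h1 ▸ mem_span_singleton_self w)
        exact ⟨v, c, hc.symm⟩
  obtain ⟨σ, u, hu, hγu⟩ := hcol.exists_semilinear hV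
  refine ⟨σ, u, hu, fun p => ?_⟩
  obtain ⟨v, hv, rfl⟩ := exists_eq_spanPoint p
  have huv : u v ≠ 0 := fun h => hv (hu.1 (h.trans (map_zero u).symm))
  have hle : (g (spanPoint hv)).1 ≤ span F {u v} := by
    rw [hγ v hv]
    exact (span_singleton_le_iff_mem _ _).2 (hγu v)
  rw [eq_of_le_of_finrank_eq hle
    ((g (spanPoint hv)).2.trans (finrank_span_singleton (K := F) huv).symm)]
  change _ = (span F {v}).map u
  rw [map_span, Set.image_singleton]

variable {j : ℕ}

/-- The permutations `f` and `g` of two consecutive Grassmannians preserve their incidence. -/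
def PreservesIncidence (f : Equiv.Perm (Grassmannian F V (j + 1)))
    (g : Equiv.Perm (Grassmannian F V j)) : Prop :=
  ∀ N s, N.1 ≤ s.1 ↔ (g N).1 ≤ (f s).1

variable {f : Equiv.Perm (Grassmannian F V (j + 1))} {g : Equiv.Perm (Grassmannian F V j)}

omit [FiniteDimensional F V] in
theorem PreservesIncidence.symm (hfg : PreservesIncidence f g) :
    PreservesIncidence f.symm g.symm := fun N s => by
  have := hfg (g.symm N) (f.symm s)
  rw [g.apply_symm_apply, f.apply_symm_apply] at this
  exact this.symm

/-- If stars go to stars in both directions, their centres are permuted. -/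
theorem exists_preservesIncidence (hj : j + 2 ≤ finrank F V) (hf : ∀ N, StarToStar f N)
    (hf' : ∀ N, StarToStar f.symm N) : ∃ g, PreservesIncidence f g := by
  choose g hg using hf
  choose g' hg' using hf'
  refine ⟨⟨g, g', fun N => ?_, fun N => ?_⟩, hg⟩
  · refine (eq_of_star_subset_star hj fun s hs => ?_).symm
    have := (hg' (g N) (f s)).1 ((hg N s).1 hs)
    rwa [f.symm_apply_apply] at this
  · refine (eq_of_star_subset_star hj fun s hs => ?_).symm
    have := (hg (g' N) (f.symm s)).1 ((hg' N s).1 hs)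
    rwa [f.apply_symm_apply] at this

theorem exists_mem_le_of_mem (hj : 1 ≤ j) {s : Grassmannian F V (j + 1)} {x : V} (hx : x ∈ s.1) :
    ∃ N : Grassmannian F V j, x ∈ N.1 ∧ N.1 ≤ s.1 := by
  obtain ⟨W, h1, h2, h3⟩ := exists_finrank_eq_between ((span_singleton_le_iff_mem x s.1).2 hx)
    (m := j) ((finrank_span_le_card {x}).trans (by simpa using hj)) (by rw [s.2]; omega)
  exact ⟨⟨W, h3⟩, h1 (mem_span_singleton_self x), h2⟩

/-- A semilinear map inducing a permutation of the `j`-planes also induces the incident permutation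
of the `(j + 1)`-planes, since a plane is the union of its subspaces of codimension one. -/
theorem PreservesIncidence.mem_linearTransformations (hj : 1 ≤ j) (hfg : PreservesIncidence f g)
    (hg : g ∈ linearTransformations F V j) : f ∈ linearTransformations F V (j + 1) := by
  obtain ⟨σ, u, hu, h⟩ := hg
  refine ⟨σ, u, hu, fun s => le_antisymm (fun y hy => ?_) ?_⟩
  · obtain ⟨N', hyN, hN⟩ := exists_mem_le_of_mem hj hy
    rw [← g.apply_symm_apply N'] at hyN hN
    rw [h] at hyN
    exact map_mono ((hfg _ _).2 hN) hyN
  · rintro _ ⟨x, hx, rfl⟩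
    obtain ⟨N, hxN, hN⟩ := exists_mem_le_of_mem hj hx
    refine (hfg _ _).1 hN ?_
    rw [h]
    exact mem_map_of_mem hxN

/-- A pair of permutations preserving incidence descends to the next lower dimension: `g` preserves
tops, because a top is the set of planes incident to a plane of the next higher dimension, and
therefore cannot map a star onto a top. -/
theorem PreservesIncidence.starToStar {f : Equiv.Perm (Grassmannian F V (j + 2))}
    {g : Equiv.Perm (Grassmannian F V (j + 1))} (hj : j + 3 ≤ finrank F V)
    (hfg : PreservesIncidence f g) (K : Grassmannian F V j) : StarToStar g K := by
  have hadj : PreservesAdjacency g := by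
    have key : ∀ {f : Equiv.Perm (Grassmannian F V (j + 2))}
        {g : Equiv.Perm (Grassmannian F V (j + 1))}, PreservesIncidence f g → ∀ s t,
        finrank F (s.1 ⊓ t.1 : Submodule F V) = j →
        finrank F ((g s).1 ⊓ (g t).1 : Submodule F V) = j := by
      intro f g hfg s t hst
      let u : Grassmannian F V (j + 2) := ⟨_, finrank_sup_of_inf hst⟩
      have hne : s ≠ t := by
        rintro rfl
        rw [inf_idem, s.2] at hst
        omega
      exact finrank_inf_eq_of_le_of_ne (f u).2 (g.injective.ne hne)
        ((hfg s u).1 le_sup_left) ((hfg t u).1 le_sup_right)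
    intro s t
    refine ⟨key hfg s t, fun h => ?_⟩
    have := key hfg.symm _ _ h
    rwa [g.symm_apply_apply, g.symm_apply_apply] at this
  rcases starToStar_or_starToTop hj hadj K with h | ⟨M, hM⟩
  · exact h
  · obtain ⟨N, hN, hNM⟩ := exists_mem_star_not_le (N := K)
      (Grassmannian.ne_top (M := f.symm M) (by omega)) (by omega)
    refine absurd ((hfg N _).2 ?_) hNM
    rw [f.apply_symm_apply]
    exact (hM N).1 hN

theorem PreservesIncidence.lower_mem_linearTransformations (hj : 1 ≤ j)
    (hj' : j + 2 ≤ finrank F V) (hfg : PreservesIncidence f g) :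
    g ∈ linearTransformations F V j := by
  induction j, hj using Nat.le_induction with
  | base =>
    refine mem_linearTransformations_of_collinear hj' fun p q r => ?_
    rcases eq_or_ne q r with rfl | hqr
    · rw [sup_idem, sup_idem]
      constructor
      · intro h
        rw [Grassmannian.eq_of_le h]
      · intro h
        rw [g.injective (Grassmannian.eq_of_le h)]
    have inf0 : ∀ {q r : Grassmannian F V 1}, q ≠ r →
        finrank F (q.1 ⊓ r.1 : Submodule F V) = 0 := fun h => by
      have := finrank_inf_lt_of_ne h
      omega
    let s : Grassmannian F V 2 := ⟨_, finrank_sup_of_inf (inf0 hqr)⟩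
    have hs : (g q).1 ⊔ (g r).1 = (f s).1 := eq_of_le_of_finrank_eq
      (sup_le ((hfg q s).1 le_sup_left) ((hfg r s).1 le_sup_right))
      ((finrank_sup_of_inf (inf0 (g.injective.ne hqr))).trans (f s).2.symm)
    rw [hs]
    exact hfg p s
  | succ j hj ih =>
    obtain ⟨h, hgh⟩ := exists_preservesIncidence (by omega) (hfg.starToStar (by omega))
      (hfg.symm.starToStar (by omega))
    exact hgh.mem_linearTransformations hj (ih (by omega) hgh)

/-- A permutation of the `(j + 1)`-planes, `1 ≤ j`, which permutes the stars is induced by a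
semilinear bijection. -/
theorem mem_linearTransformations_of_starToStar (hj : 1 ≤ j) (hj' : j + 2 ≤ finrank F V)
    (hf : ∀ N, StarToStar f N) (hf' : ∀ N, StarToStar f.symm N) :
    f ∈ linearTransformations F V (j + 1) := by
  obtain ⟨g, hfg⟩ := exists_preservesIncidence hj' hf hf'
  exact hfg.mem_linearTransformations hj (hfg.lower_mem_linearTransformations hj hj')

/-- Chow's theorem: if `f` preserves adjacency in both directions and maps one star onto a star,
it is induced by a semilinear bijection. -/
theorem PreservesAdjacency.mem_linearTransformations (hj : 1 ≤ j) (hj' : j + 3 ≤ finrank F V)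
    (hf : PreservesAdjacency f) {N : Grassmannian F V j} (hN : StarToStar f N) :
    f ∈ linearTransformations F V (j + 1) := by
  have key : ∀ {f : Equiv.Perm (Grassmannian F V (j + 1))}, PreservesAdjacency f →
      ∀ {N}, StarToStar f N → ∀ N', StarToStar f N' := by
    intro f hf N hN N'
    refine induction_adjacent (P := StarToStar f) (fun K K' hsup hK => ?_) N N' hN
    exact (starToStar_or_starToTop hj' hf K').resolve_right
      fun h => hK.not_starToTop_of_adjacent h hsup
  have hN' : ∃ N', StarToStar f.symm N' := by
    obtain ⟨N', hN'⟩ := hN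
    refine ⟨N', N, fun s => ?_⟩
    rw [hN' (f.symm s), f.apply_symm_apply]
  obtain ⟨N', hN'⟩ := hN'
  exact mem_linearTransformations_of_starToStar hj (by omega) (key hf hN) (key hf.symm hN')

end Incidence

/-! ### Subspaces spanned by vectors of a basis -/

section Coordinate

open Module (finrank Basis)
open Submodule

variable {F V ι : Type*} [Field F] [AddCommGroup V] [Module F V]

/-- `W` is a coordinate subspace for the basis `b`: it is spanned by some of the vectors of `b`. -/
def IsCoordinate (b : Basis ι F V) (W : Submodule F V) : Prop :=
  ∃ I : Set ι, W = span F (b '' I)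

variable {b d : Basis ι F V} {W W' : Submodule F V}

theorem isCoordinate_iff_eq_span : IsCoordinate b W ↔ W = span F (b '' {i | b i ∈ W}) := by
  refine ⟨?_, fun h => ⟨_, h⟩⟩
  rintro ⟨I, rfl⟩
  simp

theorem isCoordinate_iff_repr :
    IsCoordinate b W ↔ ∀ x ∈ W, ∀ i, b.repr x i ≠ 0 → b i ∈ W := by
  rw [isCoordinate_iff_eq_span]
  constructor
  · intro h x hx i hi
    rw [h, b.mem_span_image] at hx
    exact hx (by simpa using hi)
  · intro h
    refine le_antisymm (fun x hx => b.mem_span_image.2 fun i hi => h x hx i (by simpa using hi)) ?_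
    rw [span_le]
    rintro _ ⟨i, hi, rfl⟩
    exact hi

theorem IsCoordinate.inf (h : IsCoordinate b W) (h' : IsCoordinate b W') :
    IsCoordinate b (W ⊓ W') := by
  rw [isCoordinate_iff_repr] at *
  exact fun x hx i hi => ⟨h x hx.1 i hi, h' x hx.2 i hi⟩

theorem IsCoordinate.sup (h : IsCoordinate b W) (h' : IsCoordinate b W') :
    IsCoordinate b (W ⊔ W') := by
  obtain ⟨I, rfl⟩ := h
  obtain ⟨J, rfl⟩ := h'
  exact ⟨I ∪ J, by rw [Set.image_union, span_union]⟩

theorem IsCoordinate.mem_sup_iff (h : IsCoordinate b W) (h' : IsCoordinate b W') (i : ι) :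
    b i ∈ W ⊔ W' ↔ b i ∈ W ∨ b i ∈ W' := by
  obtain ⟨I, rfl⟩ := h
  obtain ⟨J, rfl⟩ := h'
  rw [← span_union, ← Set.image_union]
  simp

theorem IsCoordinate.ncard (h : IsCoordinate b W) : {i | b i ∈ W}.ncard = finrank F W := by
  have h1 := Module.finrank_eq_nat_card_basis
    (Basis.span (b.linearIndependent.comp (Subtype.val : {i | b i ∈ W} → ι)
      Subtype.val_injective))
  have h2 : Set.range (b ∘ (Subtype.val : {i | b i ∈ W} → ι)) = b '' {i | b i ∈ W} := by
    rw [Set.range_comp, Subtype.range_coe]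
  rw [h2, ← isCoordinate_iff_eq_span.1 h] at h1
  rw [h1, Nat.card_coe_set_eq]

theorem finrank_span_image_basis (b : Basis ι F V) (I : Finset ι) :
    finrank F (span F (b '' (I : Set ι))) = I.card := by
  rw [← IsCoordinate.ncard ⟨(I : Set ι), rfl⟩]
  simp

/-- If every vector of `b` is a multiple of a vector of `d` and conversely, then coordinate
subspaces for `b` are coordinate subspaces for `d`. -/
theorem IsCoordinate.of_lines (h : ∀ i, ∃ l, b i ∈ span F {d l} ∧ d l ∈ span F {b i})
    (hW : IsCoordinate b W) : IsCoordinate d W := by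
  rw [isCoordinate_iff_eq_span]
  refine le_antisymm ?_ (span_le.2 (by rintro _ ⟨i, hi, rfl⟩; exact hi))
  nth_rewrite 1 [isCoordinate_iff_eq_span.1 hW]
  rw [span_le]
  rintro _ ⟨i, hi, rfl⟩
  obtain ⟨l, h1, h2⟩ := h i
  have hl : d l ∈ W := (span_singleton_le_iff_mem _ _).2 hi h2
  have hl' : d l ∈ d '' {i | d i ∈ W} := ⟨l, hl, rfl⟩
  exact span_mono (Set.singleton_subset_iff.2 hl') h1

variable [FiniteDimensional F V]

theorem exists_basis_superset {S : Set V} (hS : LinearIndepOn F id S) :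
    ∃ b : Basis (Fin (finrank F V)) F V, S ⊆ Set.range b := by
  let b := Basis.extend hS
  have : Fintype (hS.extend (Set.subset_univ S)) := FiniteDimensional.fintypeBasisIndex b
  let e : hS.extend (Set.subset_univ S) ≃ Fin (finrank F V) :=
    Fintype.equivFinOfCardEq (Module.finrank_eq_card_basis b).symm
  refine ⟨b.reindex e, ?_⟩
  rw [Basis.range_reindex, Basis.range_extend]
  exact hS.subset_extend _

omit [FiniteDimensional F V] in
theorem isCoordinate_span {S : Set V} (h : S ⊆ Set.range b) : IsCoordinate b (span F S) := by
  obtain ⟨I, rfl⟩ := Set.subset_range_iff_exists_image_eq.1 h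
  exact ⟨I, rfl⟩

/-- Any two subspaces are coordinate subspaces for a common basis. -/
theorem exists_basis_isCoordinate_pair (s t : Submodule F V) :
    ∃ b : Basis (Fin (finrank F V)) F V, IsCoordinate b s ∧ IsCoordinate b t := by
  have span_extend : ∀ {A : Set V} (W : Submodule F V) (hA : LinearIndepOn F id A)
      (hAW : A ⊆ W), span F (hA.extend hAW) = W := fun {A} W hA hAW =>
    le_antisymm (span_le.2 (hA.extend_subset hAW)) fun x hx => by
      simpa using hA.subset_span_extend hAW hx
  have hempty : LinearIndepOn F id (∅ : Set V) := linearIndepOn_empty F id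
  let A := hempty.extend (Set.empty_subset ((s ⊓ t : Submodule F V) : Set V))
  have hA : LinearIndepOn F id A := hempty.linearIndepOn_extend _
  have hspanA : span F A = s ⊓ t := span_extend (s ⊓ t) hempty _
  have hAs : A ⊆ s := fun x hx => (hspanA.le (subset_span hx)).1
  have hAt : A ⊆ t := fun x hx => (hspanA.le (subset_span hx)).2
  let B := hA.extend hAs
  let C := hA.extend hAt
  have hB : LinearIndepOn F id B := hA.linearIndepOn_extend _
  have hC : LinearIndepOn F id C := hA.linearIndepOn_extend _
  have hAC : A ⊆ C := hA.subset_extend _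
  have hAB : A ⊆ B := hA.subset_extend _
  have hspanB : span F B = s := span_extend s hA hAs
  have hspanC : span F C = t := span_extend t hA hAt
  have hdisj : Disjoint (span F B) (span F (C \ A)) := by
    rw [disjoint_def]
    intro x hx hx'
    have hxt : x ∈ t := by
      rw [← hspanC]
      exact span_mono Set.sdiff_subset hx'
    rw [hspanB] at hx
    have hxA : x ∈ span F A := by
      rw [hspanA]
      exact ⟨hx, hxt⟩
    have hunion : LinearIndepOn F id (A ∪ (C \ A)) := by rwa [Set.union_sdiff_cancel hAC]
    exact disjoint_def.1 ((linearIndepOn_id_union_iff Set.disjoint_sdiff_right).1 hunion).2.2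
      x hxA hx'
  have hU : LinearIndepOn F id (B ∪ (C \ A)) := hB.id_union (hC.mono Set.sdiff_subset) hdisj
  obtain ⟨b, hb⟩ := exists_basis_superset hU
  refine ⟨b, ?_, ?_⟩
  · rw [← hspanB]
    exact isCoordinate_span (Set.subset_union_left.trans hb)
  · rw [← hspanC]
    refine isCoordinate_span (fun x hx => hb ?_)
    by_cases hxA : x ∈ A
    · exact Or.inl (hAB hxA)
    · exact Or.inr ⟨hx, hxA⟩

end Coordinate

/-! ### Apartments and inexact sets -/

section Apartment

open Module (finrank Basis)
open Submodule

variable {F V : Type*} [Field F] [AddCommGroup V] [Module F V]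

/-- The apartment of a basis `b`: the `k`-planes spanned by vectors of `b`. A set of planes is
regular if and only if it is contained in an apartment. -/
def apartment (k : ℕ) (b : Basis (Fin (finrank F V)) F V) : Set (Grassmannian F V k) :=
  {s | IsCoordinate b s.1}

/-- A set of planes is inexact if it is contained in two different apartments. -/
def IsInexact {k : ℕ} (X : Set (Grassmannian F V k)) : Prop :=
  ∃ b d : Basis (Fin (finrank F V)) F V,
    X ⊆ apartment k b ∧ X ⊆ apartment k d ∧ apartment k b ≠ apartment k d

variable {k : ℕ} {b d : Basis (Fin (finrank F V)) F V}

theorem apartment_eq_of_lines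
    (h : ∀ i, ∃ l, ∃ a : F, a ≠ 0 ∧ d l = a • b i) : apartment k b = apartment k d := by
  choose π a ha hπ using h
  have hinj : Function.Injective π := by
    intro i i' hii'
    by_contra hne
    have h1 := congrArg (fun v => b.repr v i) ((hπ i).symm.trans ((congrArg d hii').trans (hπ i')))
    simp [Ne.symm hne] at h1
    exact ha i h1
  have hsurj := Finite.surjective_of_injective hinj
  have h1 : ∀ i, d (π i) ∈ span F {b i} := fun i => mem_span_singleton.2 ⟨a i, (hπ i).symm⟩
  have h2 : ∀ i, b i ∈ span F {d (π i)} := fun i => mem_span_singleton.2 ⟨(a i)⁻¹, by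
    rw [hπ, smul_smul, inv_mul_cancel₀ (ha i), one_smul]⟩
  ext s
  refine ⟨IsCoordinate.of_lines fun i => ⟨π i, h2 i, h1 i⟩, IsCoordinate.of_lines fun l => ?_⟩
  obtain ⟨i, rfl⟩ := hsurj l
  exact ⟨i, h1 i, h2 i⟩

/-- If members of a subset of an apartment separate the lines of the basis, these lines are
determined, because each is an intersection of members. -/
theorem apartment_eq_of_separating {X : Set (Grassmannian F V k)} (hb : X ⊆ apartment k b)
    (hd : X ⊆ apartment k d) (h : ∀ i j, i ≠ j → ∃ s ∈ X, b i ∈ s.1 ∧ b j ∉ s.1) :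
    apartment k b = apartment k d := by
  refine apartment_eq_of_lines fun i => ?_
  obtain ⟨l, hl⟩ : ∃ l, d.repr (b i) l ≠ 0 := by
    by_contra! h0
    exact b.ne_zero i (d.ext_elem fun l => by simpa using h0 l)
  have hlX : ∀ s ∈ X, b i ∈ s.1 → d l ∈ s.1 := fun s hs his =>
    isCoordinate_iff_repr.1 (hd hs) _ his l hl
  have hsupp : ∀ j, j ≠ i → b.repr (d l) j = 0 := by
    intro j hj
    by_contra hjne
    obtain ⟨s, hs, his, hjs⟩ := h i j hj.symm
    exact hjs (isCoordinate_iff_repr.1 (hb hs) _ (hlX s hs his) j hjne)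
  have heq : d l = b.repr (d l) i • b i := by
    refine b.ext_elem fun j => ?_
    rcases eq_or_ne j i with rfl | hj
    · simp
    · simp [hsupp j hj, hj.symm]
  refine ⟨l, b.repr (d l) i, fun h0 => d.ne_zero l ?_, heq⟩
  rw [heq, h0, zero_smul]

theorem exists_mem_apartment (b : Basis (Fin (finrank F V)) F V)
    {A B : Finset (Fin (finrank F V))} (hAB : Disjoint A B) (hA : A.card ≤ k)
    (hB : B.card + k ≤ finrank F V) :
    ∃ s ∈ apartment k b, (∀ i ∈ A, b i ∈ s.1) ∧ ∀ i ∈ B, b i ∉ s.1 := by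
  have hAB' : A ⊆ Bᶜ := fun i hi => Finset.mem_compl.2 fun hi' => Finset.disjoint_left.1 hAB hi hi'
  obtain ⟨I, hAI, hIB, hI⟩ := Finset.exists_subsuperset_card_eq hAB' hA
    (by rw [Finset.card_compl, Fintype.card_fin]; omega)
  have hI' : finrank F (span F (b '' (I : Set (Fin (finrank F V))))) = k :=
    (finrank_span_image_basis b I).trans hI
  have hcoord : IsCoordinate b (span F (b '' (I : Set (Fin (finrank F V))))) := ⟨I, rfl⟩
  refine ⟨⟨_, hI'⟩, hcoord, fun i hi => ?_, fun i hi => ?_⟩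
  · exact b.self_mem_span_image.2 (hAI hi)
  · intro h
    exact Finset.mem_compl.1 (hIB (b.self_mem_span_image.1 h)) hi

theorem apartment_eq_of_subset (hk : 0 < k) (hk' : k < finrank F V)
    (h : apartment k b ⊆ apartment k d) : apartment k b = apartment k d := by
  refine apartment_eq_of_separating subset_rfl h fun i j hij => ?_
  obtain ⟨s, hs, h1, h2⟩ := exists_mem_apartment b (A := {i}) (B := {j}) (k := k)
    (by simpa using hij) (by rwa [Finset.card_singleton]) (by rw [Finset.card_singleton]; omega)
  exact ⟨s, hs, h1 i (by simp), h2 j (by simp)⟩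

/-- The maximal inexact subsets of an apartment are the sets of its members `s` such that
`b i ∈ s` implies `b j ∈ s`, for fixed `i ≠ j`. -/
theorem isInexact_iff (hk : 0 < k) (hk' : k < finrank F V) {X : Set (Grassmannian F V k)}
    (hX : X ⊆ apartment k b) :
    IsInexact X ↔ ∃ i j, i ≠ j ∧ ∀ s ∈ X, b i ∈ s.1 → b j ∈ s.1 := by
  constructor
  · rintro ⟨c, d, hc, hd, hne⟩
    by_contra! h
    exact hne ((apartment_eq_of_separating hX hc h).symm.trans (apartment_eq_of_separating hX hd h))
  · rintro ⟨i, j, hij, h⟩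
    -- Replace `b i` by `b i + b j`.
    have h0 : b.coord i (b j) = 0 := by simp [hij.symm]
    let d := b.map (LinearEquiv.transvection h0)
    have hd : ∀ l, d l = b l + b.coord i (b l) • b j := fun l => by
      simp only [d, Basis.map_apply, LinearEquiv.transvection.apply]
    have hdi : d i = b i + b j := by simp [hd]
    have hdl : ∀ l, l ≠ i → d l = b l := fun l hl => by simp [hd, hl]
    have hbi : b i = d i - d j := by rw [hdi, hdl j hij.symm, add_sub_cancel_right]
    refine ⟨b, d, hX, fun s hs => ?_, fun heq => ?_⟩
    · refine isCoordinate_iff_eq_span.2 (le_antisymm ?_ (span_le.2 ?_))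
      · nth_rewrite 1 [isCoordinate_iff_eq_span.1 (hX hs)]
        rw [span_le]
        rintro _ ⟨l, hl, rfl⟩
        rcases eq_or_ne l i with rfl | hli
        · have hj : b j ∈ s.1 := h s hs hl
          rw [hbi]
          refine sub_mem (subset_span (Set.mem_image_of_mem d ?_))
            (subset_span (Set.mem_image_of_mem d ?_))
          · change d l ∈ s.1
            rw [hdi]
            exact add_mem hl hj
          · change d j ∈ s.1
            rwa [hdl j hij.symm]
        · refine subset_span ⟨l, ?_, hdl l hli⟩
          change d l ∈ s.1
          rwa [hdl l hli]
      · rintro _ ⟨l, hl, rfl⟩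
        exact hl
    · obtain ⟨s, hs, h1, h2⟩ := exists_mem_apartment b (A := {i}) (B := {j}) (k := k)
        (by simpa using hij) (by rwa [Finset.card_singleton]) (by rw [Finset.card_singleton]; omega)
      have hbj := h2 j (by simp)
      rw [heq] at hs
      refine hbj ?_
      rw [← hdl j hij.symm]
      refine isCoordinate_iff_repr.1 hs _ (h1 i (by simp)) j ?_
      rw [hbi]
      simp [hij]

variable {f : Equiv.Perm (Grassmannian F V k)}

theorem symm_mem_regularTransformations (hf : f ∈ regularTransformations F V k) :
    f.symm ∈ regularTransformations F V k :=
  ⟨hf.2, hf.1⟩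

theorem exists_forall_map_mem_apartment (hf : f ∈ regularTransformations F V k)
    (b : Basis (Fin (finrank F V)) F V) :
    ∃ b' : Basis (Fin (finrank F V)) F V, ∀ s ∈ apartment k b, f s ∈ apartment k b' := by
  obtain ⟨b', hb'⟩ := hf.1 (apartment k b) ⟨b, fun s hs => hs⟩
  exact ⟨b', fun s hs => hb' _ ⟨s, hs, rfl⟩⟩

/-- Regular transformations map apartments onto apartments. -/
theorem exists_apartment_map (hk : 0 < k) (hk' : k < finrank F V)
    (hf : f ∈ regularTransformations F V k) (b : Basis (Fin (finrank F V)) F V) :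
    ∃ b' : Basis (Fin (finrank F V)) F V, ∀ s, s ∈ apartment k b ↔ f s ∈ apartment k b' := by
  obtain ⟨b', hb'⟩ := exists_forall_map_mem_apartment hf b
  obtain ⟨c, hc⟩ := exists_forall_map_mem_apartment (symm_mem_regularTransformations hf) b'
  refine ⟨b', fun s => ⟨hb' s, fun hs => ?_⟩⟩
  have hbc : apartment k b ⊆ apartment k c := fun t ht => by
    simpa using hc _ (hb' t ht)
  rw [apartment_eq_of_subset hk hk' hbc]
  simpa using hc _ hs

theorem IsInexact.image (hk : 0 < k) (hk' : k < finrank F V)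
    (hf : f ∈ regularTransformations F V k) {X : Set (Grassmannian F V k)} (hX : IsInexact X) :
    IsInexact (f '' X) := by
  obtain ⟨b, d, hb, hd, hne⟩ := hX
  obtain ⟨b', hb'⟩ := exists_apartment_map hk hk' hf b
  obtain ⟨d', hd'⟩ := exists_apartment_map hk hk' hf d
  refine ⟨b', d', ?_, ?_, fun h => hne ?_⟩
  · rintro _ ⟨s, hs, rfl⟩
    exact (hb' s).1 (hb hs)
  · rintro _ ⟨s, hs, rfl⟩
    exact (hd' s).1 (hd hs)
  · ext s
    rw [hb', hd', h]

/-- The members of the apartment of `b` which contain `b i` and not `b j`. These sets are the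
complements in the apartment of its maximal inexact subsets. -/
def complementSet (k : ℕ) (b : Basis (Fin (finrank F V)) F V) (i j : Fin (finrank F V)) :
    Set (Grassmannian F V k) :=
  {s | s ∈ apartment k b ∧ b i ∈ s.1 ∧ b j ∉ s.1}

theorem eq_of_complementSet_subset (hk : 2 ≤ k) (hk' : k + 2 ≤ finrank F V)
    {i j i' j' : Fin (finrank F V)} (hij : i ≠ j)
    (h : complementSet k b i j ⊆ complementSet k b i' j') : i = i' ∧ j = j' := by
  constructor
  · by_contra hne
    obtain ⟨s, hs, h1, h2⟩ := exists_mem_apartment b (A := {i}) (B := {j, i'}) (k := k)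
      (by simp [hij, hne]) (by rw [Finset.card_singleton]; omega)
      (by have := Finset.card_le_two (a := j) (b := i'); omega)
    exact h2 i' (by simp) (h ⟨hs, h1 i (by simp), h2 j (by simp)⟩).2.1
  · by_contra hne
    obtain ⟨s, hs, h1, h2⟩ := exists_mem_apartment b (A := {i, j'}) (B := {j}) (k := k)
      (by simp [hij.symm, hne])
      (by have := Finset.card_le_two (a := i) (b := j'); omega)
      (by rw [Finset.card_singleton]; omega)
    exact (h ⟨hs, h1 i (by simp), h2 j (by simp)⟩).2.2 (h1 j' (by simp))

variable {b' : Basis (Fin (finrank F V)) F V}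

theorem exists_complementSet_subset_image (hk : 0 < k) (hk' : k < finrank F V)
    (hf : f ∈ regularTransformations F V k) (hb : ∀ s, s ∈ apartment k b ↔ f s ∈ apartment k b')
    {i j : Fin (finrank F V)} (hij : i ≠ j) :
    ∃ i' j', i' ≠ j' ∧ ∀ s, f s ∈ complementSet k b' i' j' → s ∈ complementSet k b i j := by
  have h1 : IsInexact {s | s ∈ apartment k b ∧ (b i ∈ s.1 → b j ∈ s.1)} :=
    (isInexact_iff hk hk' (b := b) fun s hs => hs.1).2 ⟨i, j, hij, fun s hs => hs.2⟩
  have h2 := h1.image hk hk' hf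
  rw [isInexact_iff hk hk' (b := b')] at h2
  · obtain ⟨i', j', hij', h3⟩ := h2
    refine ⟨i', j', hij', fun s hs => ?_⟩
    by_contra hs'
    have hsb := (hb s).2 hs.1
    refine hs.2.2 (h3 _ ⟨s, ⟨hsb, fun hi => ?_⟩, rfl⟩ hs.2.1)
    by_contra hj
    exact hs' ⟨hsb, hi, hj⟩
  · rintro _ ⟨s, hs, rfl⟩
    exact (hb s).1 hs.1

/-- Regular transformations map complement sets onto complement sets. -/
theorem exists_complementSet_map (hk : 2 ≤ k) (hk' : k + 2 ≤ finrank F V)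
    (hf : f ∈ regularTransformations F V k) (hb : ∀ s, s ∈ apartment k b ↔ f s ∈ apartment k b')
    {i j : Fin (finrank F V)} (hij : i ≠ j) :
    ∃ i' j', i' ≠ j' ∧ ∀ s, s ∈ complementSet k b i j ↔ f s ∈ complementSet k b' i' j' := by
  obtain ⟨i', j', hij', h1⟩ :=
    exists_complementSet_subset_image (by omega) (by omega) hf hb hij
  have hb' : ∀ s, s ∈ apartment k b' ↔ f.symm s ∈ apartment k b := fun s => by
    rw [hb, f.apply_symm_apply]
  obtain ⟨i₂, j₂, hij₂, h2⟩ := exists_complementSet_subset_image (by omega) (by omega)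
    (symm_mem_regularTransformations hf) hb' hij'
  have h3 : ∀ s, s ∈ complementSet k b i₂ j₂ → f s ∈ complementSet k b' i' j' := fun s hs =>
    h2 (f s) (by rwa [f.symm_apply_apply])
  obtain ⟨rfl, rfl⟩ := eq_of_complementSet_subset hk hk' hij₂ fun s hs => h1 s (h3 s hs)
  exact ⟨i', j', hij', fun s => ⟨h3 s, h1 s⟩⟩

/-- The number of complement sets of an apartment containing three given members `s`, `t`, `u` is
`finrank (s ⊓ t ⊓ u) * (finrank V - finrank (s ⊔ t ⊔ u))`. -/
theorem ncard_complementSet {s t u : Grassmannian F V k} (hs : s ∈ apartment k b)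
    (ht : t ∈ apartment k b) (hu : u ∈ apartment k b) :
    {p : Fin (finrank F V) × Fin (finrank F V) | s ∈ complementSet k b p.1 p.2 ∧
        t ∈ complementSet k b p.1 p.2 ∧ u ∈ complementSet k b p.1 p.2}.ncard =
      finrank F (s.1 ⊓ t.1 ⊓ u.1 : Submodule F V) *
        (finrank F V - finrank F (s.1 ⊔ t.1 ⊔ u.1 : Submodule F V)) := by
  have hst : IsCoordinate b (s.1 ⊔ t.1) := IsCoordinate.sup hs ht
  have hinf : IsCoordinate b (s.1 ⊓ t.1 ⊓ u.1) := (IsCoordinate.inf hs ht).inf hu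
  have hsup : IsCoordinate b (s.1 ⊔ t.1 ⊔ u.1) := hst.sup hu
  have hset : {p : Fin (finrank F V) × Fin (finrank F V) | s ∈ complementSet k b p.1 p.2 ∧
        t ∈ complementSet k b p.1 p.2 ∧ u ∈ complementSet k b p.1 p.2} =
      {i | b i ∈ s.1 ⊓ t.1 ⊓ u.1} ×ˢ {j | b j ∈ s.1 ⊔ t.1 ⊔ u.1}ᶜ := by
    ext ⟨i, j⟩
    have e1 : b j ∈ s.1 ⊔ t.1 ⊔ u.1 ↔ (b j ∈ s.1 ∨ b j ∈ t.1) ∨ b j ∈ u.1 := by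
      rw [hst.mem_sup_iff hu, IsCoordinate.mem_sup_iff hs ht]
    have e2 : b i ∈ s.1 ⊓ t.1 ⊓ u.1 ↔ (b i ∈ s.1 ∧ b i ∈ t.1) ∧ b i ∈ u.1 := Iff.rfl
    simp only [complementSet, Set.mem_ofPred_eq, Set.mem_prod, Set.mem_compl_iff, e1, e2]
    tauto
  rw [hset, Set.ncard_prod, hinf.ncard, Set.ncard_compl, hsup.ncard, Nat.card_eq_fintype_card,
    Fintype.card_fin]

/-- A regular transformation preserves the number of complement sets containing three members of
an apartment. -/
theorem finrank_inf_mul_eq (hk : 2 ≤ k) (hk' : k + 2 ≤ finrank F V)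
    (hf : f ∈ regularTransformations F V k) {s t u : Grassmannian F V k}
    (hs : s ∈ apartment k b) (ht : t ∈ apartment k b) (hu : u ∈ apartment k b) :
    finrank F (s.1 ⊓ t.1 ⊓ u.1 : Submodule F V) *
        (finrank F V - finrank F (s.1 ⊔ t.1 ⊔ u.1 : Submodule F V)) =
      finrank F ((f s).1 ⊓ (f t).1 ⊓ (f u).1 : Submodule F V) *
        (finrank F V - finrank F ((f s).1 ⊔ (f t).1 ⊔ (f u).1 : Submodule F V)) := by
  have key : ∀ {f : Equiv.Perm (Grassmannian F V k)} (_ : f ∈ regularTransformations F V k)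
      {b b' : Basis (Fin (finrank F V)) F V} (_ : ∀ s, s ∈ apartment k b ↔ f s ∈ apartment k b')
      (s t u : Grassmannian F V k),
      {p : Fin (finrank F V) × Fin (finrank F V) | s ∈ complementSet k b p.1 p.2 ∧
        t ∈ complementSet k b p.1 p.2 ∧ u ∈ complementSet k b p.1 p.2}.ncard ≤
      {p : Fin (finrank F V) × Fin (finrank F V) | f s ∈ complementSet k b' p.1 p.2 ∧
        f t ∈ complementSet k b' p.1 p.2 ∧ f u ∈ complementSet k b' p.1 p.2}.ncard := by
    intro f hf b b' hb s t u
    choose! φ ψ hne hφ using fun (i j : Fin (finrank F V)) (hij : i ≠ j) =>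
      exists_complementSet_map hk hk' hf hb hij
    have hij : ∀ {i j : Fin (finrank F V)}, s ∈ complementSet k b i j → i ≠ j := by
      rintro i j hs rfl
      exact hs.2.2 hs.2.1
    refine Set.ncard_le_ncard_of_injOn (fun p => (φ p.1 p.2, ψ p.1 p.2)) ?_ ?_ (Set.toFinite _)
    · rintro ⟨i, j⟩ ⟨h1, h2, h3⟩
      have := hφ i j (hij h1)
      exact ⟨(this _).1 h1, (this _).1 h2, (this _).1 h3⟩
    · rintro ⟨i, j⟩ ⟨h1, -, -⟩ ⟨i', j'⟩ ⟨h1', -, -⟩ heq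
      obtain ⟨e1, e2⟩ := Prod.ext_iff.1 heq
      dsimp only at e1 e2 h1 h1'
      have hsub : complementSet k b i j ⊆ complementSet k b i' j' := fun v hv => by
        rw [hφ i' j' (hij h1') v, ← e1, ← e2]
        exact (hφ i j (hij h1) v).1 hv
      obtain ⟨rfl, rfl⟩ := eq_of_complementSet_subset hk hk' (hij h1) hsub
      rfl
  obtain ⟨b', hb⟩ := exists_apartment_map (by omega) (by omega) hf b
  rw [← ncard_complementSet hs ht hu,
    ← ncard_complementSet ((hb s).1 hs) ((hb t).1 ht) ((hb u).1 hu)]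
  refine le_antisymm (key hf hb s t u) ?_
  have hb' : ∀ s, s ∈ apartment k b' ↔ f.symm s ∈ apartment k b := fun s => by
    rw [hb, f.apply_symm_apply]
  have := key (symm_mem_regularTransformations hf) hb' (f s) (f t) (f u)
  simpa only [f.symm_apply_apply] using this

end Apartment

/-! ### Orthogonal complements -/

section Orthogonal

open Module (finrank Basis)
open Submodule
open LinearMap (BilinForm)

variable {F V : Type*} [Field F] [AddCommGroup V] [Module F V]

theorem mem_orthogonal_span_image {ι : Type*} {B : BilinForm F V} {v : ι → V} {I : Set ι} {y : V} :
    y ∈ B.orthogonal (span F (v '' I)) ↔ ∀ i ∈ I, B (v i) y = 0 := by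
  rw [LinearMap.BilinForm.mem_orthogonal_iff]
  refine ⟨fun h i hi => h _ (subset_span ⟨i, hi, rfl⟩), fun h n hn => ?_⟩
  have hle : span F (v '' I) ≤ LinearMap.ker (B.flip y) := by
    rw [span_le]
    rintro _ ⟨i, hi, rfl⟩
    exact h i hi
  exact hle hn

theorem exists_nondegenerate_isSymm [FiniteDimensional F V] :
    ∃ B : BilinForm F V, B.Nondegenerate ∧ B.IsSymm := by
  let b := Module.finBasis F V
  have hsymm : ∀ x y, b.toDual x y = b.toDual y x := by
    have : (b.toDual : V →ₗ[F] V →ₗ[F] F) = LinearMap.flip b.toDual := by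
      refine b.ext fun i => b.ext fun j => ?_
      rw [LinearMap.flip_apply, b.toDual_apply, b.toDual_apply]
      simp only [eq_comm]
    intro x y
    exact LinearMap.congr_fun (LinearMap.congr_fun this x) y
  have hinj : ∀ x, (∀ y, b.toDual x y = 0) → x = 0 := fun x hx =>
    b.toDual_inj x (LinearMap.ext hx)
  exact ⟨b.toDual, ⟨fun x hx => hinj x hx, fun x hx => hinj x fun y => by rw [hsymm, hx y]⟩,
    ⟨hsymm⟩⟩

variable {B : BilinForm F V}

theorem IsCoordinate.orthogonal {ι : Type*} [Finite ι] [DecidableEq ι] (hB : B.Nondegenerate)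
    (hs : B.IsSymm) {b : Basis ι F V} {W : Submodule F V} (hW : IsCoordinate b W) :
    IsCoordinate (B.dualBasis hB b) (B.orthogonal W) := by
  obtain ⟨I, rfl⟩ := hW
  refine ⟨Iᶜ, ?_⟩
  ext y
  rw [mem_orthogonal_span_image, Basis.mem_span_image]
  simp only [← hs.eq y, Set.subset_compl_iff_disjoint_right, Set.disjoint_right]
  simp

variable [FiniteDimensional F V]

theorem orthogonal_le_orthogonal_iff (hB : B.Nondegenerate) (hs : B.IsSymm) {W W' : Submodule F V} :
    B.orthogonal W ≤ B.orthogonal W' ↔ W' ≤ W := by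
  refine ⟨fun h => ?_, LinearMap.BilinForm.orthogonal_le⟩
  rw [← LinearMap.BilinForm.orthogonal_orthogonal hB hs.isRefl W,
    ← LinearMap.BilinForm.orthogonal_orthogonal hB hs.isRefl W']
  exact LinearMap.BilinForm.orthogonal_le h

/-- The permutation `s ↦ sᗮ` of the `k`-planes of a `2k`-dimensional space, for a nondegenerate
symmetric bilinear form. -/
def orthogonalPerm {k : ℕ} (hV : finrank F V = 2 * k) (hB : B.Nondegenerate) (hs : B.IsSymm) :
    Equiv.Perm (Grassmannian F V k) :=
  Function.Involutive.toPerm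
    (fun s => ⟨B.orthogonal s.1, by
      rw [LinearMap.BilinForm.finrank_orthogonal hB, s.2, hV]; omega⟩)
    (fun s => Subtype.ext (LinearMap.BilinForm.orthogonal_orthogonal hB hs.isRefl s.1))

theorem orthogonalPerm_mem_regularTransformations {k : ℕ} (hV : finrank F V = 2 * k)
    (hB : B.Nondegenerate) (hs : B.IsSymm) :
    orthogonalPerm hV hB hs ∈ regularTransformations F V k := by
  have key : ∀ R : Set (Grassmannian F V k), IsRegularSet R →
      IsRegularSet (orthogonalPerm hV hB hs '' R) := by
    rintro R ⟨b, hb⟩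
    refine ⟨B.dualBasis hB b, ?_⟩
    rintro _ ⟨s, hsR, rfl⟩
    exact IsCoordinate.orthogonal hB hs (hb s hsR)
  exact ⟨key, key⟩

end Orthogonal

/-! ### Semilinear bijections and forms induce regular transformations -/

section Induced

open Module (finrank Basis)
open Submodule
open LinearMap (BilinForm)

variable {F V : Type*} [Field F] [AddCommGroup V] [Module F V] {k : ℕ}
  {f g : Equiv.Perm (Grassmannian F V k)}

theorem one_mem_linearTransformations :
    (1 : Equiv.Perm (Grassmannian F V k)) ∈ linearTransformations F V k := by
  let u : V →ₛₗ[(RingEquiv.refl F : F →+* F)] V :=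
    { toFun := id, map_add' := fun _ _ => rfl, map_smul' := fun _ _ => rfl }
  refine ⟨RingEquiv.refl F, u, Function.bijective_id, fun s => ?_⟩
  ext x
  rw [mem_map]
  exact ⟨fun h => ⟨x, h, rfl⟩, by rintro ⟨y, hy, rfl⟩; exact hy⟩

theorem symm_mem_linearTransformations (hf : f ∈ linearTransformations F V k) :
    f.symm ∈ linearTransformations F V k := by
  obtain ⟨σ, u, hu, h⟩ := hf
  have : RingHomInvPair (σ : F →+* F) (σ.symm : F →+* F) := RingHomInvPair.of_ringEquiv σ
  have : RingHomInvPair (σ.symm : F →+* F) (σ : F →+* F) := RingHomInvPair.of_ringEquiv σ.symm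
  let e : V ≃ₛₗ[(σ : F →+* F)] V := LinearEquiv.ofBijective u hu
  refine ⟨σ.symm, e.symm.toLinearMap, e.symm.bijective, fun s => ?_⟩
  obtain ⟨t, rfl⟩ := f.surjective s
  rw [f.symm_apply_apply, h]
  ext x
  rw [mem_map]
  constructor
  · intro hx
    exact ⟨u x, mem_map_of_mem hx, e.symm_apply_apply x⟩
  · rintro ⟨_, ⟨z, hz, rfl⟩, rfl⟩
    have : e.symm (u z) = z := e.symm_apply_apply z
    exact this.symm ▸ hz

theorem mul_mem_regularTransformations (hf : f ∈ regularTransformations F V k)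
    (hg : g ∈ regularTransformations F V k) : f * g ∈ regularTransformations F V k := by
  constructor
  · intro R hR
    have := hf.1 _ (hg.1 R hR)
    rwa [← Set.image_comp] at this
  · intro R hR
    have := hg.2 _ (hf.2 R hR)
    rwa [← Set.image_comp] at this

theorem linearTransformations_subset_regularTransformations [FiniteDimensional F V] :
    linearTransformations F V k ⊆ regularTransformations F V k := by
  have key : ∀ f ∈ linearTransformations F V k, ∀ R : Set (Grassmannian F V k),
      IsRegularSet R → IsRegularSet (f '' R) := by
    rintro f ⟨σ, u, hu, h⟩ R ⟨b, hb⟩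
    have hli : LinearIndependent F (u.toAddMonoidHom ∘ b) :=
      b.linearIndependent.map_of_injective_injective σ.symm u.toAddMonoidHom
        (fun r hr => by simpa using hr) (fun m hm => hu.1 (hm.trans (map_zero u).symm))
        (fun r m => by
          change u (σ.symm r • m) = r • u m
          rw [u.map_smulₛₗ]
          simp)
    let b' := basisOfLinearIndependentOfCardEqFinrank' _ hli (by simp)
    refine ⟨b', ?_⟩
    rintro _ ⟨s, hs, rfl⟩
    obtain ⟨I, hI⟩ := hb s hs
    refine ⟨I, ?_⟩
    have hb' : (b' : Fin (finrank F V) → V) = u ∘ b := by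
      simp only [b', coe_basisOfLinearIndependentOfCardEqFinrank']
      rfl
    rw [h, hI, Submodule.map_span, hb', Set.image_comp]
  exact fun f hf => ⟨key f hf, key _ (symm_mem_linearTransformations hf)⟩

/-- The transformations given by forms are the compositions of those given by semilinear bijections
with the orthogonality of a fixed symmetric form. -/
theorem mem_formTransformations_iff [FiniteDimensional F V] {B : BilinForm F V}
    (hV : finrank F V = 2 * k) (hB : B.Nondegenerate) (hs : B.IsSymm) :
    f ∈ formTransformations F V k ↔
      orthogonalPerm hV hB hs * f ∈ linearTransformations F V k := by
  constructor
  · rintro ⟨σ₁, σ₂, Ω, hΩ, h⟩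
    -- `Ω x` is the functional `y ↦ σ₂ (B (w x) y)` for a vector `w x` depending on `x`.
    let L : V → Module.Dual F V := fun x =>
      { toFun := fun y => σ₂.symm (Ω x y)
        map_add' := fun y z => by rw [map_add, map_add]
        map_smul' := fun a y => by simp }
    let w : V → V := fun x => (B.toDual hB).symm (L x)
    have hw : ∀ x y, σ₂ (B (w x) y) = Ω x y := fun x y => by
      rw [LinearMap.BilinForm.apply_toDual_symm_apply]
      exact σ₂.apply_symm_apply _
    have hL : ∀ x y, L x y = σ₂.symm (Ω x y) := fun _ _ => rfl
    let u : V →ₛₗ[((σ₁.trans σ₂.symm : F ≃+* F) : F →+* F)] V :=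
      { toFun := w
        map_add' := fun x y => by
          rw [← map_add]
          refine congrArg _ (LinearMap.ext fun z => ?_)
          simp [hL]
        map_smul' := fun a x => by
          rw [← map_smul]
          refine congrArg _ (LinearMap.ext fun z => ?_)
          simp [hL] }
    have hu : ∀ x, u x = w x := fun _ => rfl
    refine ⟨σ₁.trans σ₂.symm, u, ⟨?_, fun v => ?_⟩, fun s => ?_⟩
    · refine (injective_iff_map_eq_zero u).2 fun x hx => hΩ.1 ?_
      refine LinearMap.ext fun y => ?_
      change Ω x y = Ω 0 y
      rw [← hw, ← hu, hx]
      simp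
    · let φ : V →ₛₗ[(σ₂ : F →+* F)] F :=
        { toFun := fun y => σ₂ (B v y)
          map_add' := fun y z => by rw [map_add, map_add]
          map_smul' := fun a y => by simp }
      obtain ⟨x, hx⟩ := hΩ.2 φ
      refine ⟨x, (B.toDual hB).injective (LinearMap.ext fun y => σ₂.injective ?_)⟩
      have := LinearMap.congr_fun hx y
      exact (hw x y).trans this
    · have hfs : (f s).1 = B.orthogonal (s.1.map u) := by
        rw [h]
        ext y
        rw [mem_orthogonalBilin_iff, LinearMap.BilinForm.mem_orthogonal_iff]
        constructor
        · rintro hy _ ⟨x, hx, rfl⟩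
          have := hy x hx
          rw [← hw] at this
          exact (map_eq_zero_iff σ₂ σ₂.injective).1 this
        · intro hy x hx
          have : B (w x) y = 0 := hy _ (mem_map_of_mem hx)
          rw [← hw, this, map_zero]
      change B.orthogonal (f s).1 = _
      rw [hfs, LinearMap.BilinForm.orthogonal_orthogonal hB hs.isRefl]
  · rintro ⟨σ, u, hu, h⟩
    let Ω : V →ₛₗ[(σ : F →+* F)] V →ₛₗ[(RingEquiv.refl F : F →+* F)] F :=
      { toFun := fun x =>
          { toFun := fun y => B (u x) y
            map_add' := fun y z => map_add _ _ _
            map_smul' := fun a y => map_smul _ _ _ }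
        map_add' := fun x y => LinearMap.ext fun z => by
          change B (u (x + y)) z = B (u x) z + B (u y) z
          rw [map_add, map_add, LinearMap.add_apply]
        map_smul' := fun a x => LinearMap.ext fun z => by
          change B (u (a • x)) z = σ a • B (u x) z
          rw [u.map_smulₛₗ, map_smul, LinearMap.smul_apply]
          rfl }
    have hΩ : ∀ x y, Ω x y = B (u x) y := fun _ _ => rfl
    refine ⟨σ, RingEquiv.refl F, Ω, ⟨fun x y hxy => ?_, fun φ => ?_⟩, fun s => ?_⟩
    · exact hu.1 ((B.toDual hB).injective (LinearMap.ext fun z => LinearMap.congr_fun hxy z))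
    · let ψ : Module.Dual F V :=
        { toFun := φ
          map_add' := fun y z => map_add _ _ _
          map_smul' := fun a y => φ.map_smulₛₗ a y }
      obtain ⟨x, hx⟩ := hu.2 ((B.toDual hB).symm ψ)
      refine ⟨x, LinearMap.ext fun y => ?_⟩
      change B (u x) y = φ y
      rw [hx, LinearMap.BilinForm.apply_toDual_symm_apply]
      rfl
    · have h' : B.orthogonal (f s).1 = s.1.map u := h s
      rw [← LinearMap.BilinForm.orthogonal_orthogonal hB hs.isRefl (f s).1, h']
      ext y
      rw [mem_orthogonalBilin_iff, LinearMap.BilinForm.mem_orthogonal_iff]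
      constructor
      · intro hy x hx
        exact hy _ (mem_map_of_mem hx)
      · rintro hy _ ⟨x, hx, rfl⟩
        exact hy x hx

end Induced

/-! ### Regular transformations of points and of hyperplanes -/

section PointsAndHyperplanes

open Module (finrank Basis)
open Submodule
open LinearMap (BilinForm)

variable {F V : Type*} [Field F] [AddCommGroup V] [Module F V] [FiniteDimensional F V]

omit [FiniteDimensional F V] in
theorem isRegularSet_triple_iff {k : ℕ} {p q r : Grassmannian F V k} :
    IsRegularSet {p, q, r} ↔ ∃ b : Basis (Fin (finrank F V)) F V,
      IsCoordinate b p.1 ∧ IsCoordinate b q.1 ∧ IsCoordinate b r.1 := by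
  refine exists_congr fun b => ?_
  refine ⟨fun h => ⟨h p (by simp), h q (by simp), h r (by simp)⟩, ?_⟩
  rintro ⟨h1, h2, h3⟩ s (rfl | rfl | rfl)
  exacts [h1, h2, h3]

/-- Three different points are collinear if and only if they do not form a regular set. -/
theorem isRegularSet_points_iff {p q r : Grassmannian F V 1} (hpq : p ≠ q) (hpr : p ≠ r)
    (hqr : q ≠ r) : IsRegularSet {p, q, r} ↔ ¬ p.1 ≤ q.1 ⊔ r.1 := by
  rw [isRegularSet_triple_iff]
  constructor
  · rintro ⟨b, hp, hq, hr⟩ hle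
    have hcard : {i | b i ∈ p.1}.ncard = 1 := hp.ncard.trans p.2
    obtain ⟨i, hi⟩ := Set.nonempty_of_ncard_ne_zero (hcard.trans_ne one_ne_zero)
    have key : ∀ {t : Grassmannian F V 1}, b i ∈ t.1 → p = t := by
      intro t ht
      have hbi : finrank F (span F {b i}) = 1 := finrank_span_singleton (b.ne_zero i)
      refine Grassmannian.eq_of_le ?_
      rw [← eq_of_le_of_finrank_eq ((span_singleton_le_iff_mem _ p.1).2 hi) (hbi.trans p.2.symm)]
      exact (span_singleton_le_iff_mem _ t.1).2 ht
    rcases (hq.mem_sup_iff hr i).1 (hle hi) with h | h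
    · exact hpq (key h)
    · exact hpr (key h)
  · intro hle
    obtain ⟨x, hx, rfl⟩ := exists_eq_spanPoint p
    obtain ⟨y, hy, rfl⟩ := exists_eq_spanPoint q
    obtain ⟨z, hz, rfl⟩ := exists_eq_spanPoint r
    have hyz : LinearIndepOn F id {y, z} := by
      refine (linearIndepOn_id_pair hy fun a ha => hqr (Grassmannian.eq_of_le ?_).symm)
      exact (span_singleton_le_iff_mem _ _).2 (mem_span_singleton.2 ⟨a, ha⟩)
    have hxyz : LinearIndepOn F id {x, y, z} := by
      refine hyz.id_insert fun h => hle ?_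
      rw [span_insert] at h
      exact (span_singleton_le_iff_mem _ _).2 h
    obtain ⟨b, hb⟩ := exists_basis_superset hxyz
    exact ⟨b, isCoordinate_span (Set.singleton_subset_iff.2 (hb (by simp))),
      isCoordinate_span (Set.singleton_subset_iff.2 (hb (by simp))),
      isCoordinate_span (Set.singleton_subset_iff.2 (hb (by simp)))⟩

/-- Dually, three different hyperplanes belong to a pencil if and only if they do not form a
regular set. -/
theorem isRegularSet_hyperplanes_iff {j : ℕ} (hV : finrank F V = j + 2)
    {s t u : Grassmannian F V (j + 1)} (hst : s ≠ t) (hsu : s ≠ u) (htu : t ≠ u) :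
    IsRegularSet {s, t, u} ↔ ¬ s.1 ⊓ t.1 ≤ u.1 := by
  obtain ⟨B, hB, hs⟩ := exists_nondegenerate_isSymm (F := F) (V := V)
  have hoo := LinearMap.BilinForm.orthogonal_orthogonal hB hs.isRefl
  have hfin : ∀ s : Grassmannian F V (j + 1), finrank F (B.orthogonal s.1) = 1 := fun s => by
    rw [LinearMap.BilinForm.finrank_orthogonal hB, s.2, hV]
    omega
  let P : Grassmannian F V (j + 1) → Grassmannian F V 1 := fun s => ⟨B.orthogonal s.1, hfin s⟩
  have hP : ∀ {s t}, s ≠ t → P s ≠ P t := fun {s t} hne h => hne (Subtype.ext (by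
    rw [← hoo s.1, ← hoo t.1]
    exact congrArg B.orthogonal (congrArg Subtype.val h)))
  have hreg : IsRegularSet {s, t, u} ↔ IsRegularSet {P u, P s, P t} := by
    rw [isRegularSet_triple_iff, isRegularSet_triple_iff]
    constructor
    · rintro ⟨b, h1, h2, h3⟩
      exact ⟨_, h3.orthogonal hB hs, h1.orthogonal hB hs, h2.orthogonal hB hs⟩
    · rintro ⟨b, h1, h2, h3⟩
      refine ⟨B.dualBasis hB b, ?_, ?_, ?_⟩
      · rw [← hoo s.1]
        exact h2.orthogonal hB hs
      · rw [← hoo t.1]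
        exact h3.orthogonal hB hs
      · rw [← hoo u.1]
        exact h1.orthogonal hB hs
  rw [hreg, isRegularSet_points_iff (hP hsu.symm) (hP htu.symm) (hP hst), not_iff_not]
  change B.orthogonal u.1 ≤ B.orthogonal s.1 ⊔ B.orthogonal t.1 ↔ _
  rw [← orthogonal_le_orthogonal_iff hB hs, hoo]
  have : B.orthogonal (B.orthogonal s.1 ⊔ B.orthogonal t.1) = s.1 ⊓ t.1 := by
    refine le_antisymm (le_inf ?_ ?_) ?_
    · exact (LinearMap.BilinForm.orthogonal_le le_sup_left).trans_eq (hoo _)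
    · exact (LinearMap.BilinForm.orthogonal_le le_sup_right).trans_eq (hoo _)
    · rw [← hoo (s.1 ⊓ t.1)]
      exact LinearMap.BilinForm.orthogonal_le (sup_le
        (LinearMap.BilinForm.orthogonal_le inf_le_left)
        (LinearMap.BilinForm.orthogonal_le inf_le_right))
  rw [this]

omit [FiniteDimensional F V] in
theorem isRegularSet_image_iff {k : ℕ} {f : Equiv.Perm (Grassmannian F V k)}
    (hf : f ∈ regularTransformations F V k) (p q r : Grassmannian F V k) :
    IsRegularSet {f p, f q, f r} ↔ IsRegularSet {p, q, r} := by
  constructor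
  · intro h
    simpa [Set.image_insert_eq] using hf.2 _ h
  · intro h
    simpa [Set.image_insert_eq] using hf.1 _ h

theorem mem_linearTransformations_of_points (hV : 3 ≤ finrank F V)
    {f : Equiv.Perm (Grassmannian F V 1)} (hf : f ∈ regularTransformations F V 1) :
    f ∈ linearTransformations F V 1 := by
  refine mem_linearTransformations_of_collinear hV fun p q r => ?_
  have hle : ∀ {p q : Grassmannian F V 1}, p.1 ≤ q.1 ↔ p = q :=
    ⟨Grassmannian.eq_of_le, fun h => h ▸ le_rfl⟩
  rcases eq_or_ne q r with rfl | hqr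
  · rw [sup_idem, sup_idem, hle, hle, f.injective.eq_iff]
  rcases eq_or_ne p q with rfl | hpq
  · exact iff_of_true le_sup_left le_sup_left
  rcases eq_or_ne p r with rfl | hpr
  · exact iff_of_true le_sup_right le_sup_right
  rw [← not_iff_not, ← isRegularSet_points_iff hpq hpr hqr, ← isRegularSet_points_iff
    (f.injective.ne hpq) (f.injective.ne hpr) (f.injective.ne hqr), isRegularSet_image_iff hf]

theorem mem_linearTransformations_of_hyperplanes {j : ℕ} (hj : 1 ≤ j) (hV : finrank F V = j + 2)
    {f : Equiv.Perm (Grassmannian F V (j + 1))} (hf : f ∈ regularTransformations F V (j + 1)) :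
    f ∈ linearTransformations F V (j + 1) := by
  have key : ∀ {f : Equiv.Perm (Grassmannian F V (j + 1))},
      f ∈ regularTransformations F V (j + 1) → ∀ N, StarToStar f N := by
    intro f hf N
    obtain ⟨s, t, hst, hN⟩ := exists_pair_inf_eq N hV.ge
    have hfin := finrank_inf_eq_of_le_of_ne (finrank_top F V ▸ hV) (f.injective.ne hst)
      (le_top : (f s).1 ≤ ⊤) (le_top : (f t).1 ≤ ⊤)
    refine ⟨⟨_, hfin⟩, fun u => ?_⟩
    rw [← hN]
    rcases eq_or_ne s u with rfl | hsu
    · exact iff_of_true inf_le_left inf_le_left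
    rcases eq_or_ne t u with rfl | htu
    · exact iff_of_true inf_le_right inf_le_right
    rw [← not_iff_not, ← isRegularSet_hyperplanes_iff hV hst hsu htu,
      ← isRegularSet_hyperplanes_iff hV (f.injective.ne hst) (f.injective.ne hsu)
      (f.injective.ne htu), isRegularSet_image_iff hf]
  exact mem_linearTransformations_of_starToStar hj hV.ge (key hf)
    (key (symm_mem_regularTransformations hf))

end PointsAndHyperplanes

/-! ### Regular transformations, stars and tops -/

section Regular

open Module (finrank Basis)
open Submodule
open LinearMap (BilinForm)

variable {F V : Type*} [Field F] [AddCommGroup V] [Module F V] [FiniteDimensional F V]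
  {j : ℕ} {f : Equiv.Perm (Grassmannian F V (j + 1))}

theorem preservesAdjacency_of_mem_regularTransformations (hj : 1 ≤ j) (hj' : j + 3 ≤ finrank F V)
    (hf : f ∈ regularTransformations F V (j + 1)) : PreservesAdjacency f := by
  intro s t
  obtain ⟨b, hs, ht⟩ := exists_basis_isCoordinate_pair s.1 t.1
  have h := finrank_inf_mul_eq (by omega) (by omega) hf (b := b) hs ht ht
  rw [inf_assoc, inf_idem, sup_assoc, sup_idem, inf_assoc, inf_idem, sup_assoc, sup_idem] at h
  have h1 := finrank_sup_add_finrank_inf_eq s.1 t.1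
  have h2 := finrank_sup_add_finrank_inf_eq (f s).1 (f t).1
  have h3 := (s.1 ⊔ t.1).finrank_le
  have h4 := ((f s).1 ⊔ (f t).1).finrank_le
  rw [s.2, t.2] at h1
  rw [(f s).2, (f t).2] at h2
  generalize finrank F (s.1 ⊓ t.1 : Submodule F V) = m at *
  generalize finrank F ((f s).1 ⊓ (f t).1 : Submodule F V) = m' at *
  generalize finrank F (s.1 ⊔ t.1 : Submodule F V) = c at *
  generalize finrank F ((f s).1 ⊔ (f t).1 : Submodule F V) = c' at *
  -- Both `m` and the codimension `a` of the sum increase when the planes move closer.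
  obtain ⟨a, ha⟩ := Nat.exists_eq_add_of_le h3
  obtain ⟨a', ha'⟩ := Nat.exists_eq_add_of_le h4
  rw [show finrank F V - c = a by omega, show finrank F V - c' = a' by omega] at h
  have hmm' : m = m' := by
    rcases lt_trichotomy m m' with hlt | heq | hlt
    · nlinarith
    · exact heq
    · nlinarith
  rw [hmm']

/-- If a regular transformation maps a star onto a top, then `finrank V` is twice the dimension of
the planes: for three planes of a star in general position, the invariant
`finrank (s ⊓ t ⊓ u) * (finrank V - finrank (s ⊔ t ⊔ u))` is `j * (finrank V - (j + 3))`, while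
for three planes of a top it is `j * (finrank V - (j + 2))` or
`(j - 1) * (finrank V - (j + 2))`. -/
theorem StarToTop.finrank_eq (hj : 1 ≤ j) (hj' : j + 3 ≤ finrank F V)
    (hf : f ∈ regularTransformations F V (j + 1)) {N : Grassmannian F V j}
    (hN : StarToTop f N) : finrank F V = 2 * (j + 1) := by
  obtain ⟨b, hb, -⟩ := exists_basis_isCoordinate_pair N.1 N.1
  have hcard : 2 < ({i | b i ∈ N.1}ᶜ : Set (Fin (finrank F V))).ncard := by
    rw [Set.ncard_compl, hb.ncard, N.2, Nat.card_eq_fintype_card, Fintype.card_fin]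
    omega
  obtain ⟨x, y, z, hx, hy, hz, hxy, hxz, hyz⟩ := (Set.two_lt_ncard_iff).1 hcard
  have hcoord : ∀ i, IsCoordinate b (span F {b i}) := fun i => isCoordinate_span (by simp)
  have hcoord' : ∀ i, IsCoordinate b (N.1 ⊔ span F {b i}) := fun i => hb.sup (hcoord i)
  have hmem : ∀ {i l}, i ≠ l → b i ∉ span F {b l} := fun {i l} hne h => by
    obtain ⟨a, ha⟩ := mem_span_singleton.1 h
    have := congrArg (fun v => b.repr v i) ha
    simp [hne.symm] at this
  have hfin : ∀ i, b i ∉ N.1 → finrank F (N.1 ⊔ span F {b i} : Submodule F V) = j + 1 :=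
    fun i hi => by rw [finrank_sup_span_singleton hi, N.2]
  have hnot : ∀ {i l}, i ≠ l → b i ∉ N.1 → b i ∉ N.1 ⊔ span F {b l} := fun {i l} hne hi h =>
    ((hb.mem_sup_iff (hcoord l) i).1 h).elim hi (hmem hne)
  let s : Grassmannian F V (j + 1) := ⟨_, hfin x hx⟩
  let t : Grassmannian F V (j + 1) := ⟨_, hfin y hy⟩
  let u : Grassmannian F V (j + 1) := ⟨_, hfin z hz⟩
  have hs : N.1 ≤ s.1 := le_sup_left
  have ht : N.1 ≤ t.1 := le_sup_left
  have hu : N.1 ≤ u.1 := le_sup_left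
  have hst : s ≠ t := fun h => by
    have h1 : b x ∈ s.1 := mem_sup_right (mem_span_singleton_self _)
    rw [h] at h1
    exact hnot hxy hx h1
  have hinf : s.1 ⊓ t.1 ⊓ u.1 = N.1 := by
    rw [inf_eq_of_le_of_ne hst hs ht, inf_eq_left.2 hu]
  have hsup2 : finrank F (s.1 ⊔ t.1 : Submodule F V) = j + 2 :=
    finrank_sup_of_inf (by rw [inf_eq_of_le_of_ne hst hs ht, N.2])
  have hsup3 : finrank F (s.1 ⊔ t.1 ⊔ u.1 : Submodule F V) = j + 3 := by
    have e : s.1 ⊔ t.1 ⊔ u.1 = s.1 ⊔ t.1 ⊔ span F {b z} := by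
      change s.1 ⊔ t.1 ⊔ (N.1 ⊔ span F {b z}) = _
      rw [← sup_assoc, sup_eq_left.2 (hs.trans le_sup_left)]
    have hz' : b z ∉ s.1 ⊔ t.1 := fun h =>
      (((hcoord' x).mem_sup_iff (hcoord' y) z).1 h).elim (hnot hxz.symm hz) (hnot hyz.symm hz)
    rw [e, finrank_sup_span_singleton hz', hsup2]
  have hsA : s ∈ apartment (j + 1) b := hcoord' x
  have htA : t ∈ apartment (j + 1) b := hcoord' y
  have huA : u ∈ apartment (j + 1) b := hcoord' z
  have hinv := finrank_inf_mul_eq (by omega) (by omega) hf hsA htA huA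
  rw [hinf, hsup3, N.2] at hinv
  obtain ⟨M, hM⟩ := hN
  have hst' := finrank_inf_eq_of_le_of_ne M.2 (f.injective.ne hst) ((hM s).1 hs) ((hM t).1 ht)
  have hsupM : (f s).1 ⊔ (f t).1 = M.1 := eq_of_le_of_finrank_eq
    (sup_le ((hM s).1 hs) ((hM t).1 ht)) ((finrank_sup_of_inf hst').trans M.2.symm)
  rw [hsupM, sup_eq_left.2 ((hM u).1 hu), M.2] at hinv
  have h1 := finrank_sup_add_finrank_inf_eq ((f s).1 ⊓ (f t).1) (f u).1
  have h2 := finrank_mono (sup_le (inf_le_left.trans ((hM s).1 hs)) ((hM u).1 hu) :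
    (f s).1 ⊓ (f t).1 ⊔ (f u).1 ≤ M.1)
  have h3 := finrank_mono (inf_le_left : (f s).1 ⊓ (f t).1 ⊓ (f u).1 ≤ (f s).1 ⊓ (f t).1)
  rw [hst', (f u).2] at h1
  rw [M.2] at h2
  rw [hst'] at h3
  generalize finrank F ((f s).1 ⊓ (f t).1 ⊓ (f u).1 : Submodule F V) = d at *
  obtain ⟨a, ha⟩ := Nat.exists_eq_add_of_le hj'
  rw [show finrank F V - (j + 3) = a by omega, show finrank F V - (j + 2) = a + 1 by omega] at hinv
  have hd : d = j ∨ d + 1 = j := by omega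
  rcases hd with rfl | rfl
  · nlinarith
  · have : a = d := by nlinarith
    omega

/-- Away from the middle dimension a regular transformation is induced by a semilinear
bijection. -/
theorem mem_linearTransformations_of_mem_regularTransformations {k : ℕ}
    (hV : finrank F V ≠ 2 * k) {f : Equiv.Perm (Grassmannian F V k)}
    (hf : f ∈ regularTransformations F V k) : f ∈ linearTransformations F V k := by
  by_cases htriv : k = 0 ∨ finrank F V ≤ k
  · have : Subsingleton (Grassmannian F V k) := by
      refine ⟨fun s t => Grassmannian.eq_of_le ?_⟩
      rcases htriv with rfl | hk
      · rw [finrank_eq_zero.1 s.2]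
        exact bot_le
      · rw [eq_top_of_finrank_eq (le_antisymm t.1.finrank_le (hk.trans_eq t.2.symm))]
        exact le_top
    rw [show f = 1 from Subsingleton.elim _ _]
    exact one_mem_linearTransformations
  push Not at htriv
  obtain ⟨j, rfl⟩ := Nat.exists_eq_succ_of_ne_zero htriv.1
  rcases Nat.eq_zero_or_pos j with rfl | hj
  · exact mem_linearTransformations_of_points (by omega) hf
  rcases eq_or_ne (finrank F V) (j + 2) with hV' | hV'
  · exact mem_linearTransformations_of_hyperplanes hj hV' hf
  have hj' : j + 3 ≤ finrank F V := by omega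
  have hadj := preservesAdjacency_of_mem_regularTransformations hj hj' hf
  obtain ⟨W, -, -, hW⟩ := exists_finrank_eq_between (bot_le : (⊥ : Submodule F V) ≤ ⊤) (m := j)
    (by simp) (by rw [finrank_top]; omega)
  rcases starToStar_or_starToTop hj' hadj ⟨W, hW⟩ with h | h
  · exact hadj.mem_linearTransformations hj hj' h
  · exact absurd (h.finrank_eq hj hj' hf) hV

/-- In the middle dimension, a regular transformation mapping stars onto tops is the composition
of orthogonality and a transformation induced by a semilinear bijection. -/
theorem mem_union_of_mem_regularTransformations (hj : 1 ≤ j) (hV : finrank F V = 2 * (j + 1))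
    (hf : f ∈ regularTransformations F V (j + 1)) :
    f ∈ linearTransformations F V (j + 1) ∪ formTransformations F V (j + 1) := by
  have hj' : j + 3 ≤ finrank F V := by omega
  have hadj := preservesAdjacency_of_mem_regularTransformations hj hj' hf
  obtain ⟨W, -, -, hW⟩ := exists_finrank_eq_between (bot_le : (⊥ : Submodule F V) ≤ ⊤) (m := j)
    (by simp) (by rw [finrank_top]; omega)
  rcases starToStar_or_starToTop hj' hadj ⟨W, hW⟩ with h | ⟨M, hM⟩
  · exact Or.inl (hadj.mem_linearTransformations hj hj' h)
  obtain ⟨B, hB, hs⟩ := exists_nondegenerate_isSymm (F := F) (V := V)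
  refine Or.inr ((mem_formTransformations_iff hV hB hs).2 ?_)
  have hreg := mul_mem_regularTransformations
    (orthogonalPerm_mem_regularTransformations hV hB hs) hf
  have hMfin : finrank F (B.orthogonal M.1) = j := by
    rw [LinearMap.BilinForm.finrank_orthogonal hB, M.2, hV]
    omega
  refine (preservesAdjacency_of_mem_regularTransformations hj hj' hreg).mem_linearTransformations
    hj hj' (N := ⟨W, hW⟩) ⟨⟨_, hMfin⟩, fun s => ?_⟩
  exact (hM s).trans (orthogonal_le_orthogonal_iff hB hs).symm

theorem formTransformations_subset_regularTransformations {k : ℕ} (hV : finrank F V = 2 * k) :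
    formTransformations F V k ⊆ regularTransformations F V k := by
  intro f hf
  obtain ⟨B, hB, hs⟩ := exists_nondegenerate_isSymm (F := F) (V := V)
  have h := linearTransformations_subset_regularTransformations
    ((mem_formTransformations_iff hV hB hs).1 hf)
  have horth := orthogonalPerm_mem_regularTransformations hV hB hs
  have := mul_mem_regularTransformations (symm_mem_regularTransformations horth) h
  rwa [← Equiv.Perm.inv_def, inv_mul_cancel_left] at this

end Regular

theorem theorem2p1p1 {F V : Type*} [Field F] [AddCommGroup V] [Module F V]
    [FiniteDimensional F V] (k : ℕ) :
    (Module.finrank F V ≠ 2 * k →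
      regularTransformations F V k = linearTransformations F V k) ∧
    (Module.finrank F V = 2 * k → 1 < k →
      regularTransformations F V k = linearTransformations F V k ∪ formTransformations F V k) := by
  refine ⟨fun hV => ?_, fun hV hk => ?_⟩
  · exact Set.Subset.antisymm
      (fun f hf => mem_linearTransformations_of_mem_regularTransformations hV hf)
      linearTransformations_subset_regularTransformations
  · obtain ⟨j, rfl⟩ := Nat.exists_eq_add_of_le' hk.le
    exact Set.Subset.antisymm
      (fun f hf => mem_union_of_mem_regularTransformations (by omega) hV hf)
      (Set.union_subset linearTransformations_subset_regularTransformations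
        (formTransformations_subset_regularTransformations hV))
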